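/- Let $X$ be an irreducible complex quasi-projective variety. Let $\mathcal E=(E_1,\ldots,E_k)$ be a collection of base-point free linear series on $X$: each $E_i$ is a finite-dimensional space of regular sections of a line bundle $\mathcal L_i$ on $X$ such that no point of $X$ is a zero of all sections in $E_i$. Put $\mathbf E=E_1\times\cdots\times E_k$. For $J\subseteq\{1,\ldots,k\}$ let $E_J=\prod_{i\in J}E_i\subseteq H^0\bigl(X,\bigotimes_{i\in J}\mathcal L_i\bigr)$ be the span of the products of sections $s_i\in E_i$, $i\in J$. Let $\Phi_J:X\to\mathbb P(E_J^*)$ be its Kodaira map, which sends $x$ to the hyperplane of sections in $E_J$ that vanish at $x$, and let $\operatorname{def}(E_J)=\dim\Phi_J(X)-|J|$ (so $\operatorname{def}(E_\varnothing)=0$). Let $\operatorname{d}(\mathcal E)=\min_{J}\operatorname{def}(E_J)$ over all $J\subseteq\{1,\ldots,k\}$. A subcollection $J$ is called essential if $\operatorname{def}(E_J)=\operatorname{d}(\mathcal E)$ and $\operatorname{def}(E_I)>\operatorname{def}(E_J)$ for every proper subset $I\subsetneq J$. The consistency variety $R_{\mathcal E}\subseteq\mathbf E$ is the Zariski closure of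 the set of all $(s_1,\ldots,s_k)\in\mathbf E$ for which the system $s_1=\cdots=s_k=0$ has at least one root in $X$; for $J\subseteq\{1,\ldots,k\}$, the consistency variety $R_{\mathcal E_J}\subseteq\prod_{i\in J}E_i$ of the collection $\mathcal E_J=(E_i)_{i\in J}$ is defined in the same way. Suppose that $\mathcal E$ is overdetermined, i.e. there is a proper Zariski closed subset $Z\subsetneq\mathbf E$ such that the system $s_1=\cdots=s_k=0$ has no root in $X$ for any $(s_1,\ldots,s_k)\in\mathbf E\setminus Z$, and let $J$ be the essential subcollection of $\mathcal E$. Then $R_{\mathcal E}$ does not depend on the $E_i$ with $i\notin J$; precisely, $$R_{\mathcal E}=p^{-1}(R_{\mathcal E_J}),$$ where $p:\mathbf E\to\prod_{i\in J}E_i$ is the natural projection. -/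

import Mathlib

open scoped LinearAlgebra.Projectivization Topology

/-! ### Zariski topologies

The polynomials on a complex vector space `V` are the polynomial expressions in the linear forms on
`V`: a `MvPolynomial` whose variables are the elements of the dual space. -/

/-- The value at `v` of a polynomial expression `F` in linear forms on `V`. -/
noncomputable def polyEval {V : Type*} [AddCommGroup V] [Module ℂ V]
    (F : MvPolynomial (Module.Dual ℂ V) ℂ) (v : V) : ℂ :=
  MvPolynomial.eval (fun φ : Module.Dual ℂ V => φ v) F

/-- The Zariski topology on (the affine space underlying) a vector space: it is generated by the
non-vanishing loci of polynomials. -/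
abbrev affineZariski (V : Type*) [AddCommGroup V] [Module ℂ V] : TopologicalSpace V :=
  TopologicalSpace.generateFrom
    {U | ∃ F : MvPolynomial (Module.Dual ℂ V) ℂ, U = {v | polyEval F v ≠ 0}}

/-- The Zariski topology on a projective space: it is generated by the non-vanishing loci of
homogeneous polynomials (whether one vanishes does not depend on the representative). -/
abbrev projectiveZariski (V : Type*) [AddCommGroup V] [Module ℂ V] : TopologicalSpace (ℙ ℂ V) :=
  TopologicalSpace.generateFrom
    {U | ∃ (d : ℕ) (F : MvPolynomial (Module.Dual ℂ V) ℂ),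
      F.IsHomogeneous d ∧ U = {p | polyEval F p.rep ≠ 0}}

/-- The Zariski topology on a subset of a projective space. -/
abbrev zariskiOn {V : Type*} [AddCommGroup V] [Module ℂ V] (X : Set (ℙ ℂ V)) :
    TopologicalSpace X :=
  (projectiveZariski V).induced Subtype.val

/-- The dimension of a subset of a projective space, in its Zariski topology. (The default `0` for
an empty or infinite-dimensional set is irrelevant for nonempty subsets of finite-dimensional
projective spaces.) -/
noncomputable def zariskiDim {V : Type*} [AddCommGroup V] [Module ℂ V] (Y : Set (ℙ ℂ V)) : ℕ :=
  ((@topologicalKrullDim Y (zariskiOn Y)).unbotD 0).toNat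

/-- An irreducible complex quasi-projective variety: an irreducible (in particular nonempty),
locally closed subset of `ℙⁿ(ℂ)`. -/
def IsIrredQuasiProjective {n : ℕ} (X : Set (ℙ ℂ (Fin (n + 1) → ℂ))) : Prop :=
  @IsLocallyClosed _ (projectiveZariski _) X ∧ @IsIrreducible _ (projectiveZariski _) X

/-! ### Regular functions, line bundles and their sections -/

section

variable {V : Type*} [AddCommGroup V] [Module ℂ V] {X : Set (ℙ ℂ V)}

/-- `f` is regular on the (open) subset `U` of `X`: locally it is a quotient of two homogeneous
polynomials of the same degree, the denominator having no zeros. -/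
def IsRegularOn (U : Set X) (f : X → ℂ) : Prop :=
  ∀ x ∈ U, ∃ W : Set X, IsOpen[zariskiOn X] W ∧ x ∈ W ∧
    ∃ (d : ℕ) (P Q : MvPolynomial (Module.Dual ℂ V) ℂ), P.IsHomogeneous d ∧ Q.IsHomogeneous d ∧
      ∀ y ∈ W ∩ U, polyEval Q y.1.rep ≠ 0 ∧ f y = polyEval P y.1.rep / polyEval Q y.1.rep

theorem IsRegularOn.mono {U U' : Set X} {f : X → ℂ} (h : IsRegularOn U f) (hU : U' ⊆ U) :
    IsRegularOn U' f := by
  intro x hx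
  obtain ⟨W, hW, hxW, d, P, Q, hP, hQ, H⟩ := h x (hU hx)
  exact ⟨W, hW, hxW, d, P, Q, hP, hQ, fun y hy => H y ⟨hy.1, hU hy.2⟩⟩

theorem isRegularOn_const (U : Set X) (c : ℂ) : IsRegularOn U (fun _ => c) := by
  intro x _
  refine ⟨Set.univ, @isOpen_univ _ (zariskiOn X), trivial, 0, MvPolynomial.C c, 1,
    MvPolynomial.isHomogeneous_C _ _, MvPolynomial.isHomogeneous_one _ _, fun y _ => ?_⟩
  simp [polyEval]

theorem IsRegularOn.add {U : Set X} {f g : X → ℂ} (hf : IsRegularOn U f) (hg : IsRegularOn U g) :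
    IsRegularOn U (fun x => f x + g x) := by
  intro x hx
  obtain ⟨W, hW, hxW, d, P, Q, hP, hQ, H⟩ := hf x hx
  obtain ⟨W', hW', hxW', d', P', Q', hP', hQ', H'⟩ := hg x hx
  refine ⟨W ∩ W', @IsOpen.inter _ (zariskiOn X) _ _ hW hW', ⟨hxW, hxW'⟩, d + d',
    P * Q' + Q * P', Q * Q', (hP.mul hQ').add (hQ.mul hP'), hQ.mul hQ', fun y hy => ?_⟩
  obtain ⟨h1, h2⟩ := H y ⟨hy.1.1, hy.2⟩
  obtain ⟨h1', h2'⟩ := H' y ⟨hy.1.2, hy.2⟩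
  have e1 : polyEval (Q * Q') y.1.rep = polyEval Q y.1.rep * polyEval Q' y.1.rep := by
    simp [polyEval]
  have e2 : polyEval (P * Q' + Q * P') y.1.rep = polyEval P y.1.rep * polyEval Q' y.1.rep +
      polyEval Q y.1.rep * polyEval P' y.1.rep := by
    simp [polyEval]
  simp only [e1, e2, h2, h2']
  exact ⟨mul_ne_zero h1 h1', div_add_div _ _ h1 h1'⟩

theorem IsRegularOn.mul {U : Set X} {f g : X → ℂ} (hf : IsRegularOn U f) (hg : IsRegularOn U g) :
    IsRegularOn U (fun x => f x * g x) := by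
  intro x hx
  obtain ⟨W, hW, hxW, d, P, Q, hP, hQ, H⟩ := hf x hx
  obtain ⟨W', hW', hxW', d', P', Q', hP', hQ', H'⟩ := hg x hx
  refine ⟨W ∩ W', @IsOpen.inter _ (zariskiOn X) _ _ hW hW', ⟨hxW, hxW'⟩, d + d',
    P * P', Q * Q', hP.mul hP', hQ.mul hQ', fun y hy => ?_⟩
  obtain ⟨h1, h2⟩ := H y ⟨hy.1.1, hy.2⟩
  obtain ⟨h1', h2'⟩ := H' y ⟨hy.1.2, hy.2⟩
  have e1 : polyEval (Q * Q') y.1.rep = polyEval Q y.1.rep * polyEval Q' y.1.rep := by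
    simp [polyEval]
  have e2 : polyEval (P * P') y.1.rep = polyEval P y.1.rep * polyEval P' y.1.rep := by
    simp [polyEval]
  simp only [e1, e2, h2, h2']
  exact ⟨mul_ne_zero h1 h1', div_mul_div_comm _ _ _ _⟩

theorem IsRegularOn.prod {κ : Type*} (S : Finset κ) {U : Set X} {f : κ → X → ℂ}
    (h : ∀ i ∈ S, IsRegularOn U (f i)) : IsRegularOn U (fun x => ∏ i ∈ S, f i x) := by
  classical
  induction S using Finset.induction_on with
  | empty => simpa using isRegularOn_const U 1
  | insert i S hi ih =>
    simp only [Finset.prod_insert hi]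
    exact (h i (Finset.mem_insert_self i S)).mul
      (ih fun j hj => h j (Finset.mem_insert_of_mem hj))

end

/-- An (algebraic) line bundle on `X`, given by a trivializing Zariski open cover and a cocycle of
regular, nowhere vanishing transition functions (only the values of `trans a b` on `U a ∩ U b`
matter). -/
structure LineBundle {V : Type*} [AddCommGroup V] [Module ℂ V] (X : Set (ℙ ℂ V)) where
  /-- the index set of the cover -/
  ι : Type
  /-- the trivializing open sets -/
  U : ι → Set X
  isOpen_U : ∀ a, IsOpen[zariskiOn X] (U a)
  covers : ∀ x, ∃ a, x ∈ U a
  /-- the transition functions -/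
  trans : ι → ι → X → ℂ
  regular_trans : ∀ a b, IsRegularOn (U a ∩ U b) (trans a b)
  trans_self : ∀ a, ∀ x ∈ U a, trans a a x = 1
  cocycle : ∀ a b c, ∀ x ∈ U a ∩ U b ∩ U c, trans a b x * trans b c x = trans a c x

section

variable {V : Type*} [AddCommGroup V] [Module ℂ V] {X : Set (ℙ ℂ V)}

/-- The space `H⁰(X, L)` of regular sections: families of regular functions on the trivializing open
sets which are related by the transition functions. (The local functions are extended by zero, so
that a section is determined by its values.) -/
def LineBundle.sections (L : LineBundle X) : Submodule ℂ (L.ι → X → ℂ) where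
  carrier := {s | (∀ a, IsRegularOn (L.U a) (s a)) ∧ (∀ a, ∀ x ∉ L.U a, s a x = 0) ∧
    ∀ a b, ∀ x ∈ L.U a ∩ L.U b, s a x = L.trans a b x * s b x}
  add_mem' := by
    rintro s t ⟨h1, h2, h3⟩ ⟨k1, k2, k3⟩
    refine ⟨fun a => (h1 a).add (k1 a), fun a x hx => ?_, fun a b x hx => ?_⟩
    · simp [h2 a x hx, k2 a x hx]
    · simp [h3 a b x hx, k3 a b x hx, mul_add]
  zero_mem' := ⟨fun a => isRegularOn_const _ 0, fun _ _ _ => rfl, fun _ _ _ _ => by simp⟩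
  smul_mem' := by
    rintro c s ⟨h1, h2, h3⟩
    refine ⟨fun a => (isRegularOn_const _ c).mul (h1 a), fun a x hx => ?_, fun a b x hx => ?_⟩
    · simp [h2 a x hx]
    · simp only [Pi.smul_apply, smul_eq_mul, h3 a b x hx]
      ring

/-- The section `s` vanishes at the point `x`. -/
def LineBundle.Vanishes (L : LineBundle X) (s : L.ι → X → ℂ) (x : X) : Prop :=
  ∀ a, x ∈ L.U a → s a x = 0

theorem LineBundle.vanishes_of_eq_zero {L : LineBundle X}
    {s : L.ι → X → ℂ} (hs : s ∈ L.sections) {x : X} {a : L.ι}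
    (ha : x ∈ L.U a) (h : s a x = 0) : L.Vanishes s x := fun b hb => by
  rw [hs.2.2 b a x ⟨hb, ha⟩, h, mul_zero]

/-- The tensor product of a finite family of line bundles. -/
noncomputable def LineBundle.tensor {κ : Type} [Fintype κ] (L : κ → LineBundle X) :
    LineBundle X where
  ι := ∀ i, (L i).ι
  U a := ⋂ i, (L i).U (a i)
  isOpen_U a := @isOpen_iInter_of_finite _ _ (zariskiOn X) _ _ fun i => (L i).isOpen_U (a i)
  covers x := by
    choose a ha using fun i => (L i).covers x
    exact ⟨a, Set.mem_iInter.2 ha⟩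
  trans a b x := ∏ i, (L i).trans (a i) (b i) x
  regular_trans a b := IsRegularOn.prod _ fun i _ => ((L i).regular_trans (a i) (b i)).mono
    fun _ hx => ⟨Set.mem_iInter.1 hx.1 i, Set.mem_iInter.1 hx.2 i⟩
  trans_self a x hx := Finset.prod_eq_one fun i _ =>
    (L i).trans_self (a i) x (Set.mem_iInter.1 hx i)
  cocycle a b c x hx := by
    rw [← Finset.prod_mul_distrib]
    exact Finset.prod_congr rfl fun i _ => (L i).cocycle (a i) (b i) (c i) x
      ⟨⟨Set.mem_iInter.1 hx.1.1 i, Set.mem_iInter.1 hx.1.2 i⟩, Set.mem_iInter.1 hx.2 i⟩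

/-- The tensor product `⨂ᵢ sᵢ` of sections `sᵢ` of `L i`: in local trivializations, the product. -/
def LineBundle.tensorSection {κ : Type} [Fintype κ] (L : κ → LineBundle X)
    (s : ∀ i, (L i).ι → X → ℂ) : (LineBundle.tensor L).ι → X → ℂ :=
  fun a x => ∏ i, s i (a i) x

theorem LineBundle.tensorSection_mem {κ : Type} [Fintype κ] {L : κ → LineBundle X}
    {s : ∀ i, (L i).ι → X → ℂ} (hs : ∀ i, s i ∈ (L i).sections) :
    LineBundle.tensorSection L s ∈ (LineBundle.tensor L).sections := by
  refine ⟨fun a => ?_, fun a x hx => ?_, fun a b x hx => ?_⟩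
  · exact IsRegularOn.prod _ fun i _ => ((hs i).1 (a i)).mono fun _ hx => Set.mem_iInter.1 hx i
  · obtain ⟨i, hi⟩ : ∃ i, x ∉ (L i).U (a i) := by
      by_contra! h
      exact hx (Set.mem_iInter.2 h)
    exact Finset.prod_eq_zero (Finset.mem_univ i) ((hs i).2.1 (a i) x hi)
  · change _ = (∏ i, (L i).trans (a i) (b i) x) * ∏ i, s i (b i) x
    rw [← Finset.prod_mul_distrib]
    exact Finset.prod_congr rfl fun i _ => (hs i).2.2 (a i) (b i) x
      ⟨Set.mem_iInter.1 hx.1 i, Set.mem_iInter.1 hx.2 i⟩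

end

/-! ### Linear series, Kodaira maps and defects -/

/-- A base-point free linear series on `X`: a finite-dimensional space of regular sections of a line
bundle such that no point of `X` is a zero of all of them. -/
structure LinearSeries {V : Type*} [AddCommGroup V] [Module ℂ V] (X : Set (ℙ ℂ V)) where
  /-- the line bundle -/
  bundle : LineBundle X
  /-- the space of sections -/
  space : Submodule ℂ (bundle.ι → X → ℂ)
  space_le : space ≤ bundle.sections
  finiteDimensional : FiniteDimensional ℂ space
  basePointFree : ∀ x : X, ∃ s ∈ space, ¬ bundle.Vanishes s x

section

variable {V : Type*} [AddCommGroup V] [Module ℂ V] {X : Set (ℙ ℂ V)}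

/-- The linear functional on `E` which sends a section to its value at `x` in the trivialization
over `U a`. -/
def LinearSeries.evalAt (E : LinearSeries X) (a : E.bundle.ι) (x : X) :
    Module.Dual ℂ E.space where
  toFun s := s.1 a x
  map_add' _ _ := rfl
  map_smul' _ _ := rfl

theorem LinearSeries.evalAt_ne_zero (E : LinearSeries X) {a : E.bundle.ι} {x : X}
    (ha : x ∈ E.bundle.U a) : E.evalAt a x ≠ 0 := by
  intro h
  obtain ⟨s, hs, hv⟩ := E.basePointFree x
  exact hv (LineBundle.vanishes_of_eq_zero (E.space_le hs) ha (LinearMap.congr_fun h ⟨s, hs⟩))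

/-- The Kodaira map `X → ℙ(E*)`: it sends `x` to the class of the functional "value at `x`", that is,
to the hyperplane of all the sections in `E` that vanish at `x`. -/
noncomputable def LinearSeries.kodaira (E : LinearSeries X) (x : X) :
    ℙ ℂ (Module.Dual ℂ E.space) :=
  Projectivization.mk ℂ (E.evalAt (E.bundle.covers x).choose x)
    (E.evalAt_ne_zero (E.bundle.covers x).choose_spec)

/-- The Kodaira map does not depend on the trivialization. -/
theorem LinearSeries.kodaira_eq (E : LinearSeries X) {a : E.bundle.ι} {x : X}
    (ha : x ∈ E.bundle.U a) :
    E.kodaira x = Projectivization.mk ℂ (E.evalAt a x) (E.evalAt_ne_zero ha) := by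
  rw [LinearSeries.kodaira, Projectivization.mk_eq_mk_iff']
  refine ⟨E.bundle.trans (E.bundle.covers x).choose a x, ?_⟩
  ext s
  exact ((E.space_le s.2).2.2 _ _ x ⟨(E.bundle.covers x).choose_spec, ha⟩).symm

/-- The product of finitely many linear series: the space of sections of the tensor product of the
line bundles which is spanned by the products of sections of the given series. -/
noncomputable def LinearSeries.prod {κ : Type} [Fintype κ] (E : κ → LinearSeries X) :
    LinearSeries X where
  bundle := LineBundle.tensor fun i => (E i).bundle
  space := Submodule.span ℂ {t | ∃ s : ∀ i, (E i).bundle.ι → X → ℂ, (∀ i, s i ∈ (E i).space) ∧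
    t = LineBundle.tensorSection (fun i => (E i).bundle) s}
  space_le := by
    rw [Submodule.span_le]
    rintro _ ⟨s, hs, rfl⟩
    exact LineBundle.tensorSection_mem fun i => (E i).space_le (hs i)
  finiteDimensional := by
    classical
    have := fun i => (E i).finiteDimensional
    let b := fun i => Module.finBasis ℂ (E i).space
    have hle : Submodule.span ℂ {t | ∃ s : ∀ i, (E i).bundle.ι → X → ℂ,
          (∀ i, s i ∈ (E i).space) ∧ t = LineBundle.tensorSection (fun i => (E i).bundle) s} ≤
        Submodule.span ℂ (Set.range fun r : (∀ i, Fin (Module.finrank ℂ (E i).space)) =>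
          LineBundle.tensorSection (fun i => (E i).bundle) fun i => (b i (r i)).1) := by
      rw [Submodule.span_le]
      rintro _ ⟨s, hs, rfl⟩
      have key : LineBundle.tensorSection (fun i => (E i).bundle) s =
          ∑ r : (∀ i, Fin (Module.finrank ℂ (E i).space)),
            (∏ i, (b i).repr ⟨s i, hs i⟩ (r i)) •
              LineBundle.tensorSection (fun i => (E i).bundle) fun i => (b i (r i)).1 := by
        funext a x
        have hx : ∀ i, s i (a i) x =
            ∑ j, (b i).repr ⟨s i, hs i⟩ j * (b i j).1 (a i) x := fun i => by
          have h := congrArg (fun t : (E i).space => t.1 (a i) x) ((b i).sum_repr ⟨s i, hs i⟩)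
          simp only [Submodule.coe_sum, Submodule.coe_smul, Finset.sum_apply, Pi.smul_apply,
            smul_eq_mul] at h
          exact h.symm
        simp only [LineBundle.tensorSection, hx, Finset.sum_apply, Pi.smul_apply, smul_eq_mul,
          ← Finset.prod_mul_distrib]
        rw [Finset.prod_univ_sum, Fintype.piFinset_univ]
      rw [key]
      exact Submodule.sum_mem _ fun r _ =>
        Submodule.smul_mem _ _ (Submodule.subset_span ⟨r, rfl⟩)
    have := FiniteDimensional.span_of_finite ℂ (Set.finite_range
      fun r : (∀ i, Fin (Module.finrank ℂ (E i).space)) =>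
        LineBundle.tensorSection (fun i => (E i).bundle) fun i => (b i (r i)).1)
    exact Submodule.finiteDimensional_of_le hle
  basePointFree x := by
    choose s hs hv using fun i => (E i).basePointFree x
    choose a ha using fun i => (E i).bundle.covers x
    refine ⟨_, Submodule.subset_span ⟨s, hs, rfl⟩, fun h => ?_⟩
    obtain ⟨i, -, hi⟩ := Finset.prod_eq_zero_iff.1 (h a (Set.mem_iInter.2 ha))
    exact hv i (LineBundle.vanishes_of_eq_zero ((E i).space_le (hs i)) (ha i) hi)

/-- The defect of the subcollection `J`: the dimension of the image of the Kodaira map of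
`E_J = ∏_{i ∈ J} E_i`, minus the number of elements of `J`. -/
noncomputable def defect {k : ℕ} (E : Fin k → LinearSeries X) (J : Finset (Fin k)) : ℤ :=
  (zariskiDim (Set.range (LinearSeries.prod fun i : J => E i).kodaira) : ℤ) - (J.card : ℤ)

/-- The minimal defect of the subcollections (including the empty one and the whole collection). -/
noncomputable def minDefect {k : ℕ} (E : Fin k → LinearSeries X) : ℤ :=
  (Finset.univ : Finset (Finset (Fin k))).inf' Finset.univ_nonempty (defect E)

/-- `J` is an essential subcollection: it has minimal defect, and its proper subcollections have
larger defects. -/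
def IsEssential {k : ℕ} (E : Fin k → LinearSeries X) (J : Finset (Fin k)) : Prop :=
  defect E J = minDefect E ∧ ∀ I, I ⊂ J → defect E J < defect E I

/-! ### Consistency varieties -/

/-- The incidence variety in `X × ∏ᵢ Eᵢ`: the points `(x, s)` for which `x` is a common root of the
system `s`. -/
def incidenceVariety {κ : Type} (E : κ → LinearSeries X) : Set (X × (∀ i, (E i).space)) :=
  {q | ∀ i, (E i).bundle.Vanishes (q.2 i).1 q.1}

/-- The consistency variety: the Zariski closure in `∏ᵢ Eᵢ` of the image of the incidence variety,
i.e. of the set of all systems that have a common root. -/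
def consistencyVariety {κ : Type} (E : κ → LinearSeries X) : Set (∀ i, (E i).space) :=
  @closure _ (affineZariski (∀ i, (E i).space)) (Prod.snd '' incidenceVariety E)

/-- The collection is overdetermined: the generic system, i.e. every system outside some proper
Zariski closed subset of `∏ᵢ Eᵢ`, has no common root on `X`. -/
def IsOverdetermined {κ : Type} (E : κ → LinearSeries X) : Prop :=
  ∃ Z : Set (∀ i, (E i).space), IsClosed[affineZariski (∀ i, (E i).space)] Z ∧ Z ≠ Set.univ ∧
    ∀ s ∉ Z, ¬ ∃ x : X, (x, s) ∈ incidenceVariety E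

end

/-! The inclusion of $R_{\mathcal E}$ in $p^{-1}(R_{\mathcal E_J})$ holds because a root of a system
is a root of its `J`-part. For the converse, let `G` be a polynomial vanishing on all solvable
systems. It is enough that `G(s) = 0` whenever the equations `s i`, `i ∈ J`, have a common root `x`;
this is `polyEval_eq_zero_of_defect_le`. With the components outside `J` frozen, `G` is then a
polynomial vanishing on the solvable `J`-systems, hence on their closure.

Choose sections `f i` that do not vanish at `x`, and let `U` be the open set where none of them
vanishes. The dimension of the Kodaira image of `E_K` is the transcendence degree of the quotients
`s / f i`, `i ∈ K`, as regular functions on `U`. Minimality of the defect of `J` therefore says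
that, for `I` disjoint from `J`, adjoining the quotients from `I` to those from `J` raises the
transcendence degree by at least `|I|`. Rado's theorem in the algebraic independence matroid then
yields quotients `h i = b i / f i`, `i ∉ J`, that are algebraically independent over an algebra `A`
containing all the quotients from `J`.

For `y ∈ U` and `ζ ∈ ℂ`, consider the system with components `s i - (s i / f i)(y) f i` for `i ∈ J`
and `t i - (t i / f i)(y) f i` for `i ∉ J`, where `t i = b i + ζ (s i - b i)`. It has the root `y`,
so `G` vanishes on it. The functions `h i + ζ e i`, with `e i = (s i - b i) / f i`, remain
independent over `A` when `ζ` is a new variable. The coefficients of `f i`, `i ∉ J`, can therefore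
be replaced by free variables, and the identity persists. Setting these variables to `0`, `ζ` to `1`
and evaluating the rest at `x` gives `G(s) = 0`, because `s i` vanishes at `x` for `i ∈ J`. -/

/-! ### Matroids: a relative form of Rado's theorem -/

/-- **Rado's theorem**, relative to a set `B`: if every subfamily of the sets `A i` raises the rank
of `B` by at least its cardinality, then so does some transversal. -/
theorem Matroid.exists_transversal_add_card_le_eRk {α ι : Type*} [Nonempty α] [DecidableEq ι]
    (M : Matroid α) (A : ι → Set α) (hA : ∀ i, M.IsRkFinite (A i)) (T : Finset ι) (B : Set α)
    (hB : M.IsRkFinite B)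
    (h : ∀ I ⊆ T, M.eRk B + I.card ≤ M.eRk (B ∪ ⋃ i ∈ I, A i)) :
    ∃ a : ι → α, (∀ i ∈ T, a i ∈ A i) ∧ M.eRk B + T.card ≤ M.eRk (B ∪ a '' T) := by
  induction T using Finset.induction_on generalizing B with
  | empty => exact ⟨fun _ => Classical.arbitrary α, by simp, by simp⟩
  | insert j T hj ih =>
    set C : Finset ι → Set α := fun I => B ∪ ⋃ i ∈ I, A i with hC
    have hCmono : ∀ {I I' : Finset ι}, I ⊆ I' → C I ⊆ C I' := fun hI =>
      Set.union_subset_union_right _ (Set.biUnion_subset_biUnion_left hI)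
    have hfin : ∀ I, M.IsRkFinite (C I) := fun I => by
      refine hB.union ?_
      have := Matroid.IsRkFinite.iUnion (M := M) (Xs := fun i : I => A i) fun i => hA i
      rwa [Set.iUnion_subtype (fun i => i ∈ I) (fun i => A i.1)] at this
    have hρ : ∀ I, ∃ r : ℕ, M.eRk (C I) = r := fun I =>
      ⟨_, (ENat.natCast_toNat ((Matroid.eRk_ne_top_iff).2 (hfin I))).symm⟩
    choose ρ hρ using hρ
    obtain ⟨b, hb⟩ : ∃ r : ℕ, M.eRk B = r :=
      ⟨_, (ENat.natCast_toNat ((Matroid.eRk_ne_top_iff).2 hB)).symm⟩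
    have h' : ∀ I ⊆ insert j T, b + I.card ≤ ρ I := fun I hI => by
      have := h I hI
      change _ ≤ M.eRk (C I) at this
      rw [hb, hρ] at this
      exact_mod_cast this
    have hsub : ∀ I I', ρ (I ∩ I') + ρ (I ∪ I') ≤ ρ I + ρ I' := fun I I' => by
      have h1 := M.eRk_inter_add_eRk_union_le (C I) (C I')
      have h2 : M.eRk (C (I ∩ I')) ≤ M.eRk (C I ∩ C I') := M.eRk_mono
        (Set.subset_inter (hCmono Finset.inter_subset_left) (hCmono Finset.inter_subset_right))
      have h3 : C (I ∪ I') ⊆ C I ∪ C I' := by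
        intro x hx
        simp only [hC, Set.mem_union, Set.mem_iUnion, Finset.mem_union] at hx ⊢
        rcases hx with hx | ⟨i, hi | hi, hx⟩
        · exact Or.inl (Or.inl hx)
        · exact Or.inl (Or.inr ⟨i, hi, hx⟩)
        · exact Or.inr (Or.inr ⟨i, hi, hx⟩)
      have h4 := (add_le_add h2 (M.eRk_mono h3)).trans h1
      simp only [hρ] at h4
      exact_mod_cast h4
    -- Call `I ⊆ T` tight if the hypothesis is an equality for it. By submodularity tight sets are
    -- closed under union, so a tight set `I₀` of maximal cardinality contains all the others.
    obtain ⟨I₀, hI₀, hmax⟩ := Finset.exists_max_image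
      (T.powerset.filter fun I => ρ I = b + I.card) Finset.card
      ⟨∅, by
        have : M.eRk (C ∅) = M.eRk B := by simp [hC]
        rw [hb, hρ] at this
        simpa using Nat.cast_injective this⟩
    simp only [Finset.mem_filter, Finset.mem_powerset, and_imp] at hI₀ hmax
    have htight : ∀ I ⊆ T, ρ I = b + I.card → I ⊆ I₀ := fun I hI hr => by
      have h1 := hsub I I₀
      have h2 := h' (I ∩ I₀) ((Finset.inter_subset_left.trans hI).trans (Finset.subset_insert _ _))
      have h3 := h' (I ∪ I₀) ((Finset.union_subset hI hI₀.1).trans (Finset.subset_insert _ _))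
      have h4 := Finset.card_inter_add_card_union I I₀
      have h5 := hmax (I ∪ I₀) (Finset.union_subset hI hI₀.1) (by omega)
      have h6 := Finset.eq_of_subset_of_card_le Finset.subset_union_right h5
      rw [h6]
      exact Finset.subset_union_left
    have hjI₀ : j ∉ I₀ := fun hj' => hj (hI₀.1 hj')
    have hlt : M.eRk (C I₀) < M.eRk (C (insert j I₀)) := by
      have h1 := h' (insert j I₀) (Finset.insert_subset_insert _ hI₀.1)
      rw [Finset.card_insert_of_notMem hjI₀] at h1
      rw [hρ, hρ]
      exact_mod_cast (by omega : ρ I₀ < ρ (insert j I₀))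
    -- Since `j ∉ I₀`, some `x ∈ A j` is independent of `C I₀`, hence of `C I` for every tight `I`.
    -- Adding `x` to `B` preserves the hypothesis: tight sets gain one in rank, and the others have
    -- one to spare.
    obtain ⟨x, ⟨hx1, hx2⟩, hx3⟩ := Matroid.exists_eRk_insert_eq_add_one_of_lt hlt
    have hxA : x ∈ A j := by
      simp only [hC, Set.mem_union, Set.mem_iUnion, Finset.mem_insert] at hx1 hx2
      rcases hx1 with hx1 | ⟨i, rfl | hi, hx1⟩
      · exact absurd (Or.inl hx1) hx2
      · exact hx1
      · exact absurd (Or.inr ⟨i, hi, hx1⟩) hx2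
    have hxcl : ∀ Y ⊆ C I₀, M.eRk (insert x Y) = M.eRk Y + 1 := fun Y hY => by
      apply Matroid.eRk_insert_eq_add_one
      refine ⟨?_, fun hcl => ?_⟩
      · by_contra hxE
        rw [Matroid.eRk_insert_of_notMem_ground _ hxE, hρ] at hx3
        have h3 : ρ I₀ = ρ I₀ + 1 := by exact_mod_cast hx3
        omega
      · have h1 := M.closure_subset_closure hY hcl
        rw [← M.eRk_closure_eq, M.closure_insert_eq_of_mem_closure h1, M.eRk_closure_eq, hρ] at hx3
        have h3 : ρ I₀ = ρ I₀ + 1 := by exact_mod_cast hx3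
        omega
    have hxB := hxcl B Set.subset_union_left
    obtain ⟨a, ha, hle⟩ := ih (insert x B) (hB.insert x) fun I hI => by
      rw [hxB, hb, Set.insert_union]
      change _ ≤ M.eRk (insert x (C I))
      have h1 := h' I (hI.trans (Finset.subset_insert _ _))
      by_cases ht : ρ I = b + I.card
      · rw [hxcl _ (hCmono (htight I hI ht)), hρ, ht]
        push_cast
        rw [add_right_comm]
      · refine le_trans ?_ (M.eRk_mono (Set.subset_insert x (C I)))
        rw [hρ]
        exact_mod_cast (by omega : b + 1 + I.card ≤ ρ I)
    have hne : ∀ i ∈ T, i ≠ j := fun i hi hij => hj (hij ▸ hi)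
    refine ⟨Function.update a j x, fun i hi => ?_, ?_⟩
    · rcases Finset.mem_insert.1 hi with rfl | hi
      · simpa using hxA
      · rw [Function.update_of_ne (hne i hi)]
        exact ha i hi
    · rw [Finset.card_insert_of_notMem hj]
      have h1 : B ∪ Function.update a j x '' ↑(insert j T) = insert x B ∪ a '' T := by
        rw [Finset.coe_insert, Set.image_insert_eq, Function.update_self,
          Set.image_congr fun i hi => Function.update_of_ne (hne i hi) x a,
          Set.union_insert, Set.insert_union]
      rw [h1]
      refine le_trans (le_of_eq ?_) hle
      rw [hxB]
      push_cast
      rw [add_assoc, add_comm (T.card : ℕ∞) 1]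

/-! ### Specialisation of algebraically independent elements -/

open Polynomial in
-- Divide a nonzero element of the kernel by the highest power of `X`; the quotient is still in the
-- kernel. At `X = 0` it becomes a relation among the `h i`, so its constant term is zero and it is
-- again divisible by `X`, a contradiction. This expresses that the `h i + X e i` stay independent
-- over `A[X]`.
theorem AlgebraicIndependent.eval₂_add_X_mul_injective {ι A O : Type*} [CommRing A] [CommRing O] [IsDomain O]
    [Algebra A O] {h : ι → O} (hh : AlgebraicIndependent A h) (e : ι → O) :
    Function.Injective (Polynomial.eval₂RingHom
      (MvPolynomial.eval₂Hom (Polynomial.C.comp (algebraMap A O))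
        (fun i => (C (h i) + X * C (e i) : O[X]))) (X : O[X])) := by
  set Φ := Polynomial.eval₂RingHom
      (MvPolynomial.eval₂Hom (Polynomial.C.comp (algebraMap A O))
        (fun i => (C (h i) + X * C (e i) : O[X]))) (X : O[X]) with hΦ
  rw [injective_iff_map_eq_zero]
  intro Q hQ
  by_contra hQ0
  obtain ⟨Q', hQ', hdvd⟩ := Polynomial.exists_eq_pow_rootMultiplicity_mul_and_not_dvd Q hQ0 0
  rw [map_zero, sub_zero] at hQ' hdvd
  have h1 : Φ Q' = 0 := by
    rw [hQ', map_mul, map_pow] at hQ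
    have hX : Φ X = X := by simp [hΦ]
    rw [hX] at hQ
    exact (mul_eq_zero.1 hQ).resolve_left (pow_ne_zero _ X_ne_zero)
  apply hdvd
  rw [X_dvd_iff]
  have h2 : ((Polynomial.evalRingHom (0 : O)).comp Φ) =
      (MvPolynomial.aeval h : MvPolynomial ι A →ₐ[A] O).toRingHom.comp
        (Polynomial.evalRingHom (0 : MvPolynomial ι A)) := by
    apply Polynomial.ringHom_ext'
    · apply MvPolynomial.ringHom_ext
      · intro r; simp [hΦ]
      · intro i; simp [hΦ]
    · simp [hΦ]
  have h3 := RingHom.congr_fun h2 Q'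
  simp only [RingHom.comp_apply, h1, map_zero] at h3
  rw [coeff_zero_eq_eval_zero]
  exact hh (by simpa using h3.symm)

/-! ### Generic extension of points -/

open Topology in
-- The statement is symmetrised for the induction: each constructible set, or else its complement,
-- is a neighbourhood of `η`. This form passes to complements and unions.
theorem Topology.IsConstructible.mem_nhds_of_generic {Y : Type*} [TopologicalSpace Y] {η : Y}
    (hη : ∀ U : Set Y, IsOpen U → U.Nonempty → η ∈ U) {s : Set Y} (hs : IsConstructible s)
    (h : η ∈ s) : s ∈ 𝓝 η := by
  have : (η ∈ s → s ∈ 𝓝 η) ∧ (η ∉ s → sᶜ ∈ 𝓝 η) := by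
    clear h
    induction hs using IsConstructible.empty_union_induction with
    | open_retrocompact U hU _ =>
      refine ⟨fun h => hU.mem_nhds h, fun h => ?_⟩
      have : U = ∅ := by
        by_contra h'
        exact h (hη U hU (Set.nonempty_iff_ne_empty.2 h'))
      simp [this]
    | union s hs t ht ihs iht =>
      refine ⟨?_, fun h => ?_⟩
      · rintro (h | h)
        · exact Filter.mem_of_superset (ihs.1 h) Set.subset_union_left
        · exact Filter.mem_of_superset (iht.1 h) Set.subset_union_right
      · rw [Set.compl_union]
        exact Filter.inter_mem (ihs.2 fun h' => h (Or.inl h')) (iht.2 fun h' => h (Or.inr h'))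
    | compl s hs ih =>
      refine ⟨fun h => ih.2 h, fun h => ?_⟩
      rw [compl_compl]
      exact ih.1 (by simpa using h)
  exact this.1 h

/-- By Chevalley, the image of `Spec B` in affine space is constructible. It contains the generic
point because the `t m` are independent, so it contains a basic open set. Over a closed point of
that set lies a maximal ideal of `B`, whose residue field is `K` by the Nullstellensatz. -/
theorem exists_algHom_of_eval_ne_zero {K B : Type*} [Field K] [IsAlgClosed K] [CommRing B] [Algebra K B]
    [Algebra.FiniteType K B] {d : ℕ} (t : Fin d → B) (ht : AlgebraicIndependent K t) :
    ∃ F : MvPolynomial (Fin d) K, F ≠ 0 ∧ ∀ a : Fin d → K, MvPolynomial.eval a F ≠ 0 →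
      ∃ ψ : B →ₐ[K] K, ∀ m, ψ (t m) = a m := by
  set g : MvPolynomial (Fin d) K →+* B := (MvPolynomial.aeval t : _ →ₐ[K] B).toRingHom with hg
  have hginj : Function.Injective g := ht
  have hfp : g.FinitePresentation := by
    rw [← RingHom.FinitePresentation.of_finiteType]
    let := g.toAlgebra
    have : IsScalarTower K (MvPolynomial (Fin d) K) B := IsScalarTower.of_algebraMap_eq' (by
      ext r
      simp [RingHom.algebraMap_toAlgebra, hg])
    have := Algebra.FiniteType.of_restrictScalars_finiteType K (MvPolynomial (Fin d) K) B
    exact this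
  have hcons := PrimeSpectrum.isConstructible_range_comap hfp
  have hbot : (⊥ : Ideal (MvPolynomial (Fin d) K)).IsPrime := Ideal.isPrime_bot
  let η : PrimeSpectrum (MvPolynomial (Fin d) K) := ⟨⊥, hbot⟩
  have hη : ∀ U : Set (PrimeSpectrum (MvPolynomial (Fin d) K)), IsOpen U → U.Nonempty → η ∈ U := by
    intro U hU ⟨x, hx⟩
    have : η ⤳ x := (PrimeSpectrum.le_iff_specializes _ _).1 (bot_le : (⊥ : Ideal _) ≤ x.asIdeal)
    exact this.mem_open hU hx
  have hmem : η ∈ Set.range (PrimeSpectrum.comap g) := by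
    obtain ⟨p, hp, h⟩ := Ideal.exists_comap_eq_of_mem_minimalPrimes_of_injective hginj ⊥
      (by rw [IsDomain.minimalPrimes_eq_singleton_bot]; rfl)
    exact ⟨⟨p, hp⟩, PrimeSpectrum.ext h⟩
  have hnhds := Topology.IsConstructible.mem_nhds_of_generic hη hcons hmem
  obtain ⟨_, ⟨F, rfl⟩, hF, hsub⟩ :=
    PrimeSpectrum.isTopologicalBasis_basic_opens.mem_nhds_iff.1 hnhds
  refine ⟨F, fun h => hF (by simp [h]), fun a ha => ?_⟩
  let ev : MvPolynomial (Fin d) K →+* K := MvPolynomial.eval a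
  have hk : (RingHom.ker ev).IsMaximal :=
    RingHom.ker_isMaximal_of_surjective ev fun c => ⟨MvPolynomial.C c, by simp [ev]⟩
  obtain ⟨P, hP⟩ := hsub (show (⟨RingHom.ker ev, hk.isPrime⟩ : PrimeSpectrum _) ∈ _ from ha)
  obtain ⟨N, hN, hPN⟩ := Ideal.exists_le_maximal P.asIdeal P.isPrime.ne_top
  have hcomap : RingHom.ker ev ≤ N.comap g := by
    have := congrArg PrimeSpectrum.asIdeal hP
    rw [← show P.asIdeal.comap g = RingHom.ker ev from this]
    exact Ideal.comap_mono hPN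
  let : Field (B ⧸ N) := Ideal.Quotient.field N
  have : Module.Finite K (B ⧸ N) := finite_of_finite_type_of_isJacobsonRing K (B ⧸ N)
  let e := AlgEquiv.ofBijective (Algebra.ofId K (B ⧸ N))
    (IsAlgClosed.algebraMap_bijective_of_isIntegral (k := K) (K := B ⧸ N))
  refine ⟨e.symm.toAlgHom.comp (Ideal.Quotient.mkₐ K N), fun m => ?_⟩
  have h1 : (MvPolynomial.X m - MvPolynomial.C (a m) : MvPolynomial (Fin d) K) ∈ RingHom.ker ev := by
    simp [RingHom.mem_ker, ev]
  have h2 := hcomap h1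
  rw [Ideal.mem_comap, map_sub, ← Ideal.Quotient.eq] at h2
  change e.symm (Ideal.Quotient.mk N (t m)) = a m
  rw [AlgEquiv.symm_apply_eq]
  have h3 : g (MvPolynomial.X m) = t m := by simp [hg]
  have h4 : g (MvPolynomial.C (a m)) = algebraMap K B (a m) := by simp [hg]
  rw [h3, h4] at h2
  rw [h2]
  rfl

/-! ### Chains of primes -/

open Algebra in
-- Noether normalisation: `K[S]` is integral over a polynomial ring in `s` variables, so chains of
-- primes have length at most `s`. The images of the variables are `s` independent elements in the
-- matroid closure of `S`.
theorem le_eRk_of_strictAnti_primeSpectrum {K O : Type*} [Field K] [CommRing O] [IsDomain O]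
    [Algebra K O] (S : Set O) [hft : Algebra.FiniteType K (adjoin K S)] {m : ℕ}
    (c : Fin (m + 1) → PrimeSpectrum (adjoin K S)) (hc : StrictAnti c) :
    (m : ℕ∞) ≤ (AlgebraicIndependent.matroid K O).eRk S := by
  obtain ⟨s, g, hginj, hgint⟩ := exists_integral_inj_algHom_of_fg K (adjoin K S)
  have hm : m ≤ s := by
    have h1 : StrictMono fun x : Fin (m + 1) =>
        (PrimeSpectrum.comap g.toRingHom (c x.rev)) := by
      intro x y hxy
      have h1 : c x.rev < c y.rev := hc (Fin.rev_lt_rev.2 hxy)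
      let := g.toRingHom.toAlgebra
      have : Algebra.IsIntegral (MvPolynomial (Fin s) K) (adjoin K S) := ⟨hgint⟩
      exact Ideal.IsIntegral.comap_lt_comap (R := MvPolynomial (Fin s) K) h1
    have h2 : (m : WithBot ℕ∞) ≤ ringKrullDim (MvPolynomial (Fin s) K) :=
      Order.LTSeries.length_le_krullDim (LTSeries.mk m _ h1)
    rw [MvPolynomial.ringKrullDim_of_isNoetherianRing, ringKrullDim_eq_zero_of_field] at h2
    simpa using h2
  have hind : AlgebraicIndependent K (fun i => ((g (MvPolynomial.X i) : adjoin K S) : O)) :=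
    ((MvPolynomial.algebraicIndependent_X (Fin s) K).map' hginj).map' (f := (adjoin K S).val)
      Subtype.val_injective
  have hsub : Set.range (fun i => ((g (MvPolynomial.X i) : adjoin K S) : O)) ⊆
      (AlgebraicIndependent.matroid K O).closure S := by
    rintro _ ⟨i, rfl⟩
    rw [AlgebraicIndependent.matroid_closure_eq]
    exact isAlgebraic_algebraMap (g (MvPolynomial.X i))
  have h1 : (AlgebraicIndependent.matroid K O).Indep
      (Set.range (fun i => ((g (MvPolynomial.X i) : adjoin K S) : O))) := hind.coe_range
  have h2 := h1.encard_le_eRk_of_subset hsub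
  rw [Matroid.eRk_closure_eq, ← Set.image_univ, hind.injective.encard_image, Set.encard_univ] at h2
  refine le_trans ?_ h2
  simpa using hm

/-! ### A lower bound for the dimension of a Noetherian space -/

open TopologicalSpace in
/-- If the image of a map from a Noetherian space to `K ^ d`, along which polynomials pull back to
continuous functions for the Zariski topology, contains a nonempty principal open set, then the
space has dimension at least `d`. -/
theorem le_topologicalKrullDim_of_eval_ne_zero {K : Type*} [Field K] [Infinite K] (d : ℕ) {W : Type*} [TopologicalSpace W]
    [NoetherianSpace W] (T : W → Fin d → K)
    (hT : ∀ F : MvPolynomial (Fin d) K, IsOpen {w | MvPolynomial.eval (T w) F ≠ 0})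
    (F₀ : MvPolynomial (Fin d) K) (hF₀ : F₀ ≠ 0)
    (himg : ∀ a, MvPolynomial.eval a F₀ ≠ 0 → ∃ w, T w = a) :
    (d : WithBot ℕ∞) ≤ topologicalKrullDim W := by
  have hpt : ∃ v, MvPolynomial.eval v F₀ ≠ 0 := by
    by_contra! h
    exact hF₀ (MvPolynomial.funext fun v => by simpa using h v)
  obtain ⟨v, hv⟩ := hpt
  classical
  induction d generalizing W with
  | zero =>
    obtain ⟨w, -⟩ := himg v hv
    have : Nonempty (IrreducibleCloseds W) :=
      ⟨⟨closure {w}, isIrreducible_singleton.closure, isClosed_closure⟩⟩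
    simpa [topologicalKrullDim] using Order.krullDim_nonneg
  | succ d ih =>
    -- `p` is `F₀` on the line through `v` in the direction of the first coordinate; `R a` below is
    -- `F₀` on the hyperplane where that coordinate is `a`. For all `a` outside the finitely many
    -- roots of `p`, induction applies to the slice `T w 0 = a`.
    let p : Polynomial K :=
      MvPolynomial.aeval (Fin.cons Polynomial.X fun i => Polynomial.C (v i.succ)) F₀
    have hp : ∀ a, p.eval a = MvPolynomial.eval (Fin.cons a fun i => v i.succ) F₀ := fun a => by
      rw [← Polynomial.coe_aeval_eq_eval, MvPolynomial.comp_aeval_apply,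
        ← MvPolynomial.aeval_eq_eval]
      congr 2
      funext i
      refine Fin.cases ?_ (fun i => ?_) i <;> simp
    have hp0 : p ≠ 0 := fun h => hv (by
      have := hp (v 0)
      rw [h, Polynomial.eval_zero] at this
      rw [show v = Fin.cons (v 0) fun i => v i.succ from (Fin.cons_self_tail v).symm]
      exact this.symm)
    let R : K → MvPolynomial (Fin d) K := fun a =>
      MvPolynomial.aeval (Fin.cons (MvPolynomial.C a) MvPolynomial.X) F₀
    have hR : ∀ a u, MvPolynomial.eval u (R a) = MvPolynomial.eval (Fin.cons a u) F₀ := fun a u => by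
      rw [← MvPolynomial.aeval_eq_eval, ← MvPolynomial.aeval_eq_eval,
        MvPolynomial.comp_aeval_apply]
      congr 2
      funext i
      refine Fin.cases ?_ (fun i => ?_) i <;> simp
    have hgood : Set.Infinite {a | p.eval a ≠ 0} := by
      have h1 : Set.Finite {a | p.eval a = 0} := by
        refine (p.roots.toFinset.finite_toSet).subset fun a ha => ?_
        simpa [hp0] using ha
      exact h1.infinite_compl
    have hclosed : ∀ a, IsClosed {w | T w 0 = a} := fun a => by
      have := (hT (MvPolynomial.X 0 - MvPolynomial.C a)).isClosed_compl
      convert this using 1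
      ext w
      simp [sub_eq_zero]
    have hchain : ∀ a, p.eval a ≠ 0 → ∃ c : LTSeries (IrreducibleCloseds W), c.length = d ∧
        (c.last : Set W) ⊆ {w | T w 0 = a} := fun a ha => by
      have h1 := ih (W := {w | T w 0 = a}) (fun w i => T w.1 i.succ) (fun F => by
        have h2 := (hT (MvPolynomial.rename Fin.succ F)).preimage
          (continuous_subtype_val (p := fun w => w ∈ {w | T w 0 = a}))
        convert h2 using 1
        ext w
        simp only [Set.mem_preimage, Set.mem_ofPred_eq, MvPolynomial.eval_rename, Function.comp_def]) (R a) (fun h => ha (by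
          have := hR a fun i => v i.succ
          rw [h, map_zero] at this
          rw [hp, ← this])) (fun u hu => by
          rw [hR] at hu
          obtain ⟨w, hw⟩ := himg _ hu
          exact ⟨⟨w, by simp [hw]⟩, by simp [hw]⟩) (fun i => v i.succ) (by rwa [hR, ← hp])
      obtain ⟨c, hc⟩ := Order.le_krullDim_iff.1 h1
      refine ⟨c.map _ (IrreducibleCloseds.map_strictMono_of_isInducing
        (Topology.IsInducing.subtypeVal (t := {w | T w 0 = a}))), hc, ?_⟩
      rw [LTSeries.last_map, IrreducibleCloseds.coe_map]
      refine closure_minimal ?_ (hclosed a)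
      rintro _ ⟨w, -, rfl⟩
      exact w.2
    have hcomp : ∀ c : LTSeries (IrreducibleCloseds W), ∃ Z : irreducibleComponents W, (c.last : Set W) ⊆ Z :=
      fun c => by
        obtain ⟨Z, hZ, h⟩ := exists_mem_irreducibleComponents_subset_of_isIrreducible _ c.last.2
        exact ⟨⟨Z, hZ⟩, h⟩
    have : Nonempty (LTSeries (IrreducibleCloseds W)) := by
      obtain ⟨c, -⟩ := hchain (v 0) (by
        rw [hp, show (Fin.cons (v 0) fun i => v i.succ) = v from Fin.cons_self_tail v]
        exact hv)
      exact ⟨c⟩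
    choose! c hc hca using hchain
    choose Z hZ using hcomp
    have : Finite (irreducibleComponents W) := NoetherianSpace.finite_irreducibleComponents
    -- Infinitely many slices, finitely many irreducible components: the chains of two different
    -- slices lie in the same component. That component is contained in neither slice, so it
    -- prolongs the chain for `a` by one.
    obtain ⟨a, ha, b, hb, hab, hZab⟩ := hgood.exists_ne_map_eq_of_mapsTo
      (f := fun a => Z (c a)) (fun _ _ => Set.mem_univ _) Set.finite_univ
    have hlt : (c a).last < ⟨(Z (c a) : Set W), (Z (c a)).2.1,
        isClosed_of_mem_irreducibleComponents _ (Z (c a)).2⟩ := by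
      refine lt_of_le_of_ne (hZ _) fun h => ?_
      obtain ⟨w, hw⟩ := (c b).last.2.nonempty
      have h1 : T w 0 = b := hca b hb hw
      have h2 : w ∈ ((c a).last : Set W) := by
        rw [h]
        have := hZ (c b) hw
        rwa [← hZab] at this
      exact hab ((hca a ha h2).symm.trans h1)
    rw [topologicalKrullDim]
    refine Order.le_krullDim_iff.2 ⟨(c a).snoc _ hlt, ?_⟩
    simp [hc a ha]

/-! ### Values of polynomials -/

section

variable {V : Type*} [AddCommGroup V] [Module ℂ V]

theorem polyEval_mul (F G : MvPolynomial (Module.Dual ℂ V) ℂ) (v : V) :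
    polyEval (F * G) v = polyEval F v * polyEval G v := map_mul _ F G

theorem polyEval_add (F G : MvPolynomial (Module.Dual ℂ V) ℂ) (v : V) :
    polyEval (F + G) v = polyEval F v + polyEval G v := map_add _ F G

@[simp] theorem polyEval_X (φ : Module.Dual ℂ V) (v : V) :
    polyEval (MvPolynomial.X φ) v = φ v := by simp [polyEval]

@[simp] theorem polyEval_C (c : ℂ) (v : V) : polyEval (MvPolynomial.C c) v = c := by
  simp [polyEval]

@[simp] theorem polyEval_one (v : V) : polyEval 1 v = 1 := by simp [polyEval]

theorem polyEval_smul {F : MvPolynomial (Module.Dual ℂ V) ℂ} {d : ℕ} (hF : F.IsHomogeneous d)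
    (c : ℂ) (v : V) : polyEval F (c • v) = c ^ d * polyEval F v := by
  simp only [polyEval, MvPolynomial.eval_eq, map_smul, smul_eq_mul, mul_pow,
    Finset.prod_mul_distrib, Finset.mul_sum]
  refine Finset.sum_congr rfl fun m hm => ?_
  have h1 : ∏ i ∈ m.support, c ^ m i = c ^ d := by
    rw [Finset.prod_pow_eq_pow_sum, hF.degree_eq_sum_deg_support hm]
  rw [h1]
  ring

theorem exists_smul_eq_rep_mk (v : V) (hv : v ≠ 0) :
    ∃ c : ℂ, c ≠ 0 ∧ (Projectivization.mk ℂ v hv).rep = c • v := by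
  obtain ⟨a, ha⟩ := Projectivization.exists_smul_eq_mk_rep ℂ v hv
  exact ⟨a, a.ne_zero, ha.symm⟩

theorem polyEval_rep_mk_eq_zero_iff {F : MvPolynomial (Module.Dual ℂ V) ℂ} {d : ℕ}
    (hF : F.IsHomogeneous d) {v : V} (hv : v ≠ 0) :
    polyEval F (Projectivization.mk ℂ v hv).rep = 0 ↔ polyEval F v = 0 := by
  obtain ⟨c, hc, h⟩ := exists_smul_eq_rep_mk v hv
  rw [h, polyEval_smul hF]
  simp [hc]

/-! ### Zariski open sets -/

theorem isOpen_projectiveZariski_iff {U : Set (ℙ ℂ V)} :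
    IsOpen[projectiveZariski V] U ↔ ∀ p ∈ U, ∃ (d : ℕ) (F : MvPolynomial (Module.Dual ℂ V) ℂ),
      F.IsHomogeneous d ∧ polyEval F p.rep ≠ 0 ∧ ∀ q, polyEval F q.rep ≠ 0 → q ∈ U := by
  constructor
  · intro h
    induction h with
    | basic s hs =>
      obtain ⟨d, F, hF, rfl⟩ := hs
      exact fun p hp => ⟨d, F, hF, hp, fun q hq => hq⟩
    | univ => exact fun p _ => ⟨0, 1, MvPolynomial.isHomogeneous_one _ _, by simp, by simp⟩
    | inter s t _ _ ihs iht =>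
      rintro p ⟨hps, hpt⟩
      obtain ⟨d, F, hF, h1, h2⟩ := ihs p hps
      obtain ⟨e, G, hG, h3, h4⟩ := iht p hpt
      refine ⟨d + e, F * G, hF.mul hG, ?_, fun q hq => ?_⟩
      · rw [polyEval_mul]; exact mul_ne_zero h1 h3
      · rw [polyEval_mul] at hq
        exact ⟨h2 q (left_ne_zero_of_mul hq), h4 q (right_ne_zero_of_mul hq)⟩
    | sUnion S _ ih =>
      rintro p ⟨s, hs, hp⟩
      obtain ⟨d, F, hF, h1, h2⟩ := ih s hs p hp
      exact ⟨d, F, hF, h1, fun q hq => ⟨s, hs, h2 q hq⟩⟩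
  · intro h
    let := projectiveZariski V
    rw [isOpen_iff_forall_mem_open]
    intro p hp
    obtain ⟨d, F, hF, h1, h2⟩ := h p hp
    exact ⟨{q | polyEval F q.rep ≠ 0}, h2,
      TopologicalSpace.isOpen_generateFrom_of_mem ⟨d, F, hF, rfl⟩, h1⟩

theorem isOpen_affineZariski_iff {U : Set V} :
    IsOpen[affineZariski V] U ↔ ∀ p ∈ U, ∃ F : MvPolynomial (Module.Dual ℂ V) ℂ,
      polyEval F p ≠ 0 ∧ ∀ q, polyEval F q ≠ 0 → q ∈ U := by
  constructor
  · intro h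
    induction h with
    | basic s hs =>
      obtain ⟨F, rfl⟩ := hs
      exact fun p hp => ⟨F, hp, fun q hq => hq⟩
    | univ => exact fun p _ => ⟨1, by simp, by simp⟩
    | inter s t _ _ ihs iht =>
      rintro p ⟨hps, hpt⟩
      obtain ⟨F, h1, h2⟩ := ihs p hps
      obtain ⟨G, h3, h4⟩ := iht p hpt
      refine ⟨F * G, ?_, fun q hq => ?_⟩
      · rw [polyEval_mul]; exact mul_ne_zero h1 h3
      · rw [polyEval_mul] at hq
        exact ⟨h2 q (left_ne_zero_of_mul hq), h4 q (right_ne_zero_of_mul hq)⟩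
    | sUnion S _ ih =>
      rintro p ⟨s, hs, hp⟩
      obtain ⟨F, h1, h2⟩ := ih s hs p hp
      exact ⟨F, h1, fun q hq => ⟨s, hs, h2 q hq⟩⟩
  · intro h
    let := affineZariski V
    rw [isOpen_iff_forall_mem_open]
    intro p hp
    obtain ⟨F, h1, h2⟩ := h p hp
    exact ⟨{q | polyEval F q ≠ 0}, h2, TopologicalSpace.isOpen_generateFrom_of_mem ⟨F, rfl⟩, h1⟩

variable {X : Set (ℙ ℂ V)}

theorem isOpen_zariskiOn_iff {W : Set X} :
    IsOpen[zariskiOn X] W ↔ ∀ x ∈ W, ∃ (d : ℕ) (F : MvPolynomial (Module.Dual ℂ V) ℂ),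
      F.IsHomogeneous d ∧ polyEval F x.1.rep ≠ 0 ∧ ∀ y : X, polyEval F y.1.rep ≠ 0 → y ∈ W := by
  constructor
  · rintro ⟨O, hO, rfl⟩ x hx
    obtain ⟨d, F, hF, h1, h2⟩ := isOpen_projectiveZariski_iff.1 hO x.1 hx
    exact ⟨d, F, hF, h1, fun y hy => h2 _ hy⟩
  · intro h
    let := zariskiOn X
    rw [isOpen_iff_forall_mem_open]
    intro x hx
    obtain ⟨d, F, hF, h1, h2⟩ := h x hx
    refine ⟨{y | polyEval F y.1.rep ≠ 0}, h2, ?_, h1⟩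
    exact ⟨{q | polyEval F q.rep ≠ 0},
      TopologicalSpace.isOpen_generateFrom_of_mem ⟨d, F, hF, rfl⟩, rfl⟩

theorem isOpen_zariskiOn_polyEval_ne_zero {F : MvPolynomial (Module.Dual ℂ V) ℂ} {d : ℕ}
    (hF : F.IsHomogeneous d) : IsOpen[zariskiOn X] {y : X | polyEval F y.1.rep ≠ 0} :=
  isOpen_zariskiOn_iff.2 fun _ hx => ⟨d, F, hF, hx, fun _ hy => hy⟩

/-- Nonempty open subsets of an irreducible set meet. -/
theorem IsIrreducible.inter_nonempty_of_isOpen_zariskiOn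
    (hX : @IsIrreducible _ (projectiveZariski V) X) {W W' : Set X}
    (hW : IsOpen[zariskiOn X] W) (hW' : IsOpen[zariskiOn X] W') (h : W.Nonempty)
    (h' : W'.Nonempty) : (W ∩ W').Nonempty := by
  obtain ⟨O, hO, rfl⟩ := hW
  obtain ⟨O', hO', rfl⟩ := hW'
  obtain ⟨x, hx⟩ := h
  obtain ⟨x', hx'⟩ := h'
  obtain ⟨y, hy, h1, h2⟩ := hX.2 O O' hO hO' ⟨x, x.2, hx⟩ ⟨x', x'.2, hx'⟩
  exact ⟨⟨y, hy⟩, h1, h2⟩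

/-! ### Regular functions -/

theorem IsRegularOn.isOpen_ne_zero {U : Set X} {f : X → ℂ} (hU : IsOpen[zariskiOn X] U)
    (hf : IsRegularOn U f) : IsOpen[zariskiOn X] {x | x ∈ U ∧ f x ≠ 0} := by
  let := zariskiOn X
  rw [isOpen_iff_forall_mem_open]
  rintro x ⟨hx, hfx⟩
  obtain ⟨W, hW, hxW, d, P, Q, hP, hQ, H⟩ := hf x hx
  refine ⟨W ∩ U ∩ {y : X | polyEval P y.1.rep ≠ 0}, ?_,
    (hW.inter hU).inter (isOpen_zariskiOn_polyEval_ne_zero hP), ⟨⟨hxW, hx⟩, fun h => hfx ?_⟩⟩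
  · rintro y ⟨hy, hPy⟩
    refine ⟨hy.2, ?_⟩
    rw [(H y hy).2]
    exact div_ne_zero hPy (H y hy).1
  · rw [(H x ⟨hxW, hx⟩).2, h, zero_div]

theorem IsRegularOn.div {U : Set X} {f g : X → ℂ} (hf : IsRegularOn U f) (hg : IsRegularOn U g)
    (h0 : ∀ x ∈ U, g x ≠ 0) : IsRegularOn U (fun x => f x / g x) := by
  intro x hx
  obtain ⟨W, hW, hxW, d, P, Q, hP, hQ, H⟩ := hf x hx
  obtain ⟨W', hW', hxW', d', P', Q', hP', hQ', H'⟩ := hg x hx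
  refine ⟨W ∩ W', @IsOpen.inter _ (zariskiOn X) _ _ hW hW', ⟨hxW, hxW'⟩, d + d',
    P * Q', Q * P', hP.mul hQ', hQ.mul hP', fun y hy => ?_⟩
  obtain ⟨h1, h2⟩ := H y ⟨hy.1.1, hy.2⟩
  obtain ⟨h1', h2'⟩ := H' y ⟨hy.1.2, hy.2⟩
  have h3 : polyEval P' y.1.rep ≠ 0 := fun h => h0 y hy.2 (by rw [h2', h, zero_div])
  simp only [polyEval_mul, h2, h2']
  exact ⟨mul_ne_zero h1 h3, div_div_div_eq _ _ _ _⟩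

theorem IsRegularOn.congr {U : Set X} {f g : X → ℂ} (hf : IsRegularOn U f)
    (h : ∀ x ∈ U, g x = f x) : IsRegularOn U g := by
  intro x hx
  obtain ⟨W, hW, hxW, d, P, Q, hP, hQ, H⟩ := hf x hx
  exact ⟨W, hW, hxW, d, P, Q, hP, hQ, fun y hy => ⟨(H y hy).1, by rw [h y hy.2, (H y hy).2]⟩⟩

/-- Regularity is a local property. -/
theorem isRegularOn_of_locally {U : Set X} {f : X → ℂ}
    (h : ∀ x ∈ U, ∃ U', IsOpen[zariskiOn X] U' ∧ x ∈ U' ∧ IsRegularOn (U ∩ U') f) :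
    IsRegularOn U f := by
  intro x hx
  obtain ⟨U', hU', hxU', hf⟩ := h x hx
  obtain ⟨W, hW, hxW, d, P, Q, hP, hQ, H⟩ := hf x ⟨hx, hxU'⟩
  exact ⟨W ∩ U', @IsOpen.inter _ (zariskiOn X) _ _ hW hU', ⟨hxW, hxU'⟩, d, P, Q, hP, hQ,
    fun y hy => H y ⟨hy.1.1, hy.2, hy.1.2⟩⟩

theorem isRegularOn_div_polyEval {U : Set X} {d : ℕ} {P Q : MvPolynomial (Module.Dual ℂ V) ℂ}
    (hP : P.IsHomogeneous d) (hQ : Q.IsHomogeneous d) (h : ∀ x ∈ U, polyEval Q x.1.rep ≠ 0) :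
    IsRegularOn U (fun x => polyEval P x.1.rep / polyEval Q x.1.rep) :=
  fun _ _ => ⟨Set.univ, @isOpen_univ _ (zariskiOn X), trivial, d, P, Q, hP, hQ,
    fun y hy => ⟨h y hy.2, rfl⟩⟩

theorem IsRegularOn.eval_mvPolynomial {U : Set X} {σ : Type*} {t : σ → X → ℂ}
    (ht : ∀ m, IsRegularOn U (t m)) (F : MvPolynomial σ ℂ) :
    IsRegularOn U (fun x => MvPolynomial.eval (fun m => t m x) F) := by
  induction F using MvPolynomial.induction_on with
  | C c => simpa using isRegularOn_const U c
  | add p q hp hq => simpa using hp.add hq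
  | mul_X p m hp => simpa using hp.mul (ht m)

/-- A regular function on an irreducible variety that vanishes on a nonempty open set is zero. -/
theorem IsRegularOn.eq_zero_of_isOpen (hX : @IsIrreducible _ (projectiveZariski V) X) {U W : Set X}
    {f : X → ℂ} (hU : IsOpen[zariskiOn X] U) (hf : IsRegularOn U f) (hW : IsOpen[zariskiOn X] W)
    (hne : W.Nonempty) (h : ∀ x ∈ W, x ∈ U → f x = 0) {x : X} (hx : x ∈ U) : f x = 0 := by
  by_contra hfx
  obtain ⟨y, hyW, hyU, hfy⟩ :=
    hX.inter_nonempty_of_isOpen_zariskiOn hW (hf.isOpen_ne_zero hU) hne ⟨x, hx, hfx⟩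
  exact hfy (h y hyW hyU)

/-- The algebra of regular functions on `U`. -/
def regularFunctions (U : Set X) : Subalgebra ℂ (U → ℂ) where
  carrier := {p | ∃ f : X → ℂ, IsRegularOn U f ∧ ∀ x : U, p x = f x}
  mul_mem' := by
    rintro p q ⟨f, hf, h⟩ ⟨g, hg, h'⟩
    exact ⟨_, hf.mul hg, fun x => by simp [h, h']⟩
  add_mem' := by
    rintro p q ⟨f, hf, h⟩ ⟨g, hg, h'⟩
    exact ⟨_, hf.add hg, fun x => by simp [h, h']⟩
  algebraMap_mem' c := ⟨_, isRegularOn_const U c, fun _ => rfl⟩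

/-- The element of `regularFunctions U` defined by a function that is regular on `U`. -/
def IsRegularOn.toRegularFunctions {U : Set X} {f : X → ℂ} (hf : IsRegularOn U f) :
    regularFunctions U := ⟨fun x => f x, f, hf, fun _ => rfl⟩

/-- Evaluation of regular functions at a point. -/
def evalRegular {U : Set X} (x : U) : regularFunctions U →ₐ[ℂ] ℂ :=
  (Pi.evalAlgHom ℂ (fun _ : U => ℂ) x).comp (regularFunctions U).val

@[simp] theorem evalRegular_toRegularFunctions {U : Set X} {f : X → ℂ} (hf : IsRegularOn U f)
    (x : U) : evalRegular x hf.toRegularFunctions = f x := rfl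

theorem regularFunctions_ext {U : Set X} {p q : regularFunctions U}
    (h : ∀ x : U, evalRegular x p = evalRegular x q) : p = q :=
  Subtype.ext (funext h)

theorem isDomain_regularFunctions (hX : @IsIrreducible _ (projectiveZariski V) X) {U : Set X}
    (hU : IsOpen[zariskiOn X] U) (hne : U.Nonempty) : IsDomain (regularFunctions U) := by
  rw [isDomain_iff_noZeroDivisors_and_nontrivial]
  obtain ⟨x₀, hx₀⟩ := hne
  refine ⟨⟨fun {p q} hpq => ?_⟩, ⟨0, 1, fun h => ?_⟩⟩
  · by_contra! hne
    obtain ⟨p, f, hf, hp⟩ := p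
    obtain ⟨q, g, hg, hq⟩ := q
    have key : ∀ {r : regularFunctions U} {e : X → ℂ}, (∀ x : U, r.1 x = e x) → r ≠ 0 →
        {x | x ∈ U ∧ e x ≠ 0}.Nonempty := by
      intro r e he hr
      by_contra h
      rw [Set.not_nonempty_iff_eq_empty] at h
      refine hr (regularFunctions_ext fun x => ?_)
      by_contra hx
      have : (x : X) ∈ {x | x ∈ U ∧ e x ≠ 0} := ⟨x.2, by rw [← he]; exact hx⟩
      rw [h] at this
      exact this
    obtain ⟨y, ⟨hyU, hfy⟩, -, hgy⟩ := hX.inter_nonempty_of_isOpen_zariskiOn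
      (hf.isOpen_ne_zero hU) (hg.isOpen_ne_zero hU) (key hp hne.1) (key hq hne.2)
    have h1 := congrFun (congrArg Subtype.val hpq) ⟨y, hyU⟩
    have h2 : p ⟨y, hyU⟩ * q ⟨y, hyU⟩ = 0 := h1
    rw [hp, hq] at h2
    exact mul_ne_zero hfy hgy h2
  · have h1 := congrFun (congrArg Subtype.val h) ⟨x₀, hx₀⟩
    exact zero_ne_one (α := ℂ) h1

instance faithfulSMul_regularFunctions {U : Set X} [IsDomain (regularFunctions U)] :
    FaithfulSMul ℂ (regularFunctions U) :=
  (faithfulSMul_iff_algebraMap_injective _ _).2 (algebraMap ℂ (regularFunctions U)).injective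

end

section

variable {V : Type*} [AddCommGroup V] [Module ℂ V]

/-! ### The Zariski topology is Noetherian -/

theorem Module.Basis.dual_apply_eq_sum {ι : Type*} [Fintype ι] (b : Module.Basis ι ℂ V)
    (φ : Module.Dual ℂ V) (v : V) : φ v = ∑ i, φ (b i) * b.repr v i := by
  conv_lhs => rw [← b.sum_repr v, map_sum]
  exact Finset.sum_congr rfl fun i _ => by rw [map_smul, smul_eq_mul, mul_comm]

theorem exists_mvPolynomial_eval_repr {ι : Type*} [Fintype ι] (b : Module.Basis ι ℂ V)
    (F : MvPolynomial (Module.Dual ℂ V) ℂ) :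
    ∃ G : MvPolynomial ι ℂ, ∀ v, MvPolynomial.eval (b.repr v) G = polyEval F v := by
  refine ⟨MvPolynomial.aeval (fun φ : Module.Dual ℂ V =>
    ∑ i, MvPolynomial.C (φ (b i)) * MvPolynomial.X i) F, fun v => ?_⟩
  rw [polyEval, ← MvPolynomial.aeval_eq_eval, ← MvPolynomial.aeval_eq_eval,
    MvPolynomial.comp_aeval_apply]
  congr 2
  funext φ
  simp [b.dual_apply_eq_sum φ v]

open TopologicalSpace in
-- Open sets embed strictly monotonically into the ideals of a Noetherian polynomial ring. The ideal
-- tests vanishing at the chosen representatives and need not be homogeneous; its homogeneous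
-- members already separate open sets.
theorem noetherianSpace_projectiveZariski [FiniteDimensional ℂ V] :
    @NoetherianSpace _ (projectiveZariski V) := by
  let := projectiveZariski V
  let b := Module.finBasis ℂ V
  let I : Opens (ℙ ℂ V) → Ideal (MvPolynomial (Fin (Module.finrank ℂ V)) ℂ) := fun U =>
    { carrier := {G | ∀ p ∉ U, MvPolynomial.eval (b.repr p.rep) G = 0}
      add_mem' := fun hF hG p hp => by rw [map_add, hF p hp, hG p hp, add_zero]
      zero_mem' := fun p _ => map_zero _
      smul_mem' := fun F G hG p hp => by rw [smul_eq_mul, map_mul, hG p hp, mul_zero] }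
  have hI : StrictMono I := by
    intro U U' h
    refine lt_of_le_of_ne (fun G hG p hp => hG p fun hp' => hp (h.le hp')) fun heq => ?_
    obtain ⟨p, hp', hp⟩ := Set.exists_of_ssubset h
    obtain ⟨d, F, hF, h1, h2⟩ := isOpen_projectiveZariski_iff.1 U'.2 p hp'
    obtain ⟨G, hG⟩ := exists_mvPolynomial_eval_repr b F
    have h3 : G ∈ I U' := fun q hq => by
      rw [hG]
      by_contra h'
      exact hq (h2 q h')
    rw [← heq] at h3
    exact h1 (by rw [← hG]; exact h3 p hp)
  exact hI.wellFoundedGT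

/-! ### Values and ratios of sections -/

variable {X : Set (ℙ ℂ V)}

namespace LinearSeries

/-- The functional "value at `x`", in a chosen trivialization. -/
noncomputable def valueAt (E : LinearSeries X) (x : X) : Module.Dual ℂ E.space :=
  E.evalAt (E.bundle.covers x).choose x

theorem valueAt_ne_zero (E : LinearSeries X) (x : X) : E.valueAt x ≠ 0 :=
  E.evalAt_ne_zero (E.bundle.covers x).choose_spec

theorem vanishes_iff_valueAt (E : LinearSeries X) (s : E.space) (x : X) :
    E.bundle.Vanishes s.1 x ↔ E.valueAt x s = 0 :=
  ⟨fun h => h _ (E.bundle.covers x).choose_spec,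
    fun h => LineBundle.vanishes_of_eq_zero (E.space_le s.2) (E.bundle.covers x).choose_spec h⟩

theorem exists_valueAt_eq_mul (E : LinearSeries X) {x : X} {a : E.bundle.ι}
    (ha : x ∈ E.bundle.U a) :
    ∃ c : ℂ, c ≠ 0 ∧ ∀ s : E.space, E.valueAt x s = c * s.1 a x := by
  have hb := (E.bundle.covers x).choose_spec
  refine ⟨E.bundle.trans (E.bundle.covers x).choose a x, fun h => ?_,
    fun s => (E.space_le s.2).2.2 _ _ x ⟨hb, ha⟩⟩
  have h1 := E.bundle.cocycle _ a _ x ⟨⟨hb, ha⟩, hb⟩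
  rw [h, zero_mul, E.bundle.trans_self _ x hb] at h1
  exact zero_ne_one h1

/-- The set of points where the section `f` does not vanish. -/
def nonvanishing (E : LinearSeries X) (f : E.space) : Set X := {x | E.valueAt x f ≠ 0}

/-- The quotient of two sections, as a function. -/
noncomputable def ratio (E : LinearSeries X) (f s : E.space) (x : X) : ℂ :=
  E.valueAt x s / E.valueAt x f

theorem ratio_eq (E : LinearSeries X) (f s : E.space) {x : X} {a : E.bundle.ι}
    (ha : x ∈ E.bundle.U a) : E.ratio f s x = s.1 a x / f.1 a x := by
  obtain ⟨c, hc, h⟩ := E.exists_valueAt_eq_mul ha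
  rw [ratio, h, h, mul_div_mul_left _ _ hc]

theorem mem_nonvanishing_iff (E : LinearSeries X) (f : E.space) {x : X} {a : E.bundle.ι}
    (ha : x ∈ E.bundle.U a) : x ∈ E.nonvanishing f ↔ f.1 a x ≠ 0 := by
  obtain ⟨c, hc, h⟩ := E.exists_valueAt_eq_mul ha
  simp [nonvanishing, h, hc]

theorem isOpen_nonvanishing (E : LinearSeries X) (f : E.space) :
    IsOpen[zariskiOn X] (E.nonvanishing f) := by
  let := zariskiOn X
  rw [isOpen_iff_forall_mem_open]
  intro x hx
  obtain ⟨a, ha⟩ := E.bundle.covers x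
  exact ⟨_, fun y hy => (E.mem_nonvanishing_iff f hy.1).2 hy.2,
    ((E.space_le f.2).1 a).isOpen_ne_zero (E.bundle.isOpen_U a),
    ha, (E.mem_nonvanishing_iff f ha).1 hx⟩

theorem isRegularOn_ratio (E : LinearSeries X) (f s : E.space) :
    IsRegularOn (E.nonvanishing f) (E.ratio f s) := by
  refine isRegularOn_of_locally fun x _ => ?_
  obtain ⟨a, ha⟩ := E.bundle.covers x
  refine ⟨E.bundle.U a, E.bundle.isOpen_U a, ha, ?_⟩
  refine IsRegularOn.congr (f := fun x => s.1 a x / f.1 a x) ?_ fun y hy => E.ratio_eq f s hy.2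
  exact (((E.space_le s.2).1 a).mono fun y hy => hy.2).div
    (((E.space_le f.2).1 a).mono fun y hy => hy.2)
    fun y hy => (E.mem_nonvanishing_iff f hy.2).1 hy.1

/-- The linear map which sends a section `s` to the regular function `s / f`. -/
noncomputable def ratioOn (E : LinearSeries X) {f : E.space} {U : Set X}
    (hU : U ⊆ E.nonvanishing f) : E.space →ₗ[ℂ] regularFunctions U where
  toFun s := ((E.isRegularOn_ratio f s).mono hU).toRegularFunctions
  map_add' s t := regularFunctions_ext fun x => by
    simp [ratio, add_div]
  map_smul' c s := regularFunctions_ext fun x => by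
    simp [ratio, mul_div_assoc]

@[simp] theorem evalRegular_ratioOn (E : LinearSeries X) {f : E.space} {U : Set X}
    (hU : U ⊆ E.nonvanishing f) (s : E.space) (x : U) :
    evalRegular x (E.ratioOn hU s) = E.ratio f s x := rfl

theorem ratioOn_self (E : LinearSeries X) {f : E.space} {U : Set X}
    (hU : U ⊆ E.nonvanishing f) : E.ratioOn hU f = 1 :=
  regularFunctions_ext fun x => by
    rw [evalRegular_ratioOn, map_one]
    exact div_self (hU x.2)

theorem exists_rep_kodaira_eq (E : LinearSeries X) (x : X) :
    ∃ c : ℂ, c ≠ 0 ∧ (E.kodaira x).rep = c • E.valueAt x :=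
  exists_smul_eq_rep_mk _ _

theorem rep_kodaira_div (E : LinearSeries X) (f s : E.space) (x : X) :
    (E.kodaira x).rep s / (E.kodaira x).rep f = E.ratio f s x := by
  obtain ⟨c, hc, h⟩ := E.exists_rep_kodaira_eq x
  rw [h, ratio]
  exact mul_div_mul_left _ _ hc

theorem rep_kodaira_ne_zero_iff (E : LinearSeries X) (f : E.space) (x : X) :
    (E.kodaira x).rep f ≠ 0 ↔ x ∈ E.nonvanishing f := by
  obtain ⟨c, hc, h⟩ := E.exists_rep_kodaira_eq x
  simp [h, nonvanishing, hc]

end LinearSeries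

end

/-! ### Images of regular maps -/

/-- The image of a quasi-projective variety under algebraically independent regular functions
contains a nonempty principal open subset of affine space. -/
theorem exists_forall_eval_ne_zero_mem_image {n : ℕ} {X : Set (ℙ ℂ (Fin (n + 1) → ℂ))}
    (hX : IsIrredQuasiProjective X) {U : Set X} (hU : IsOpen[zariskiOn X] U) (hne : U.Nonempty)
    {d : ℕ} (t : Fin d → X → ℂ) (ht : ∀ m, IsRegularOn U (t m))
    (hind : AlgebraicIndependent ℂ fun m => (ht m).toRegularFunctions) :
    ∃ F : MvPolynomial (Fin d) ℂ, F ≠ 0 ∧ ∀ a, MvPolynomial.eval a F ≠ 0 →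
      ∃ x ∈ U, ∀ m, t m x = a m := by
  obtain ⟨x₀, hx₀⟩ := hne
  obtain ⟨O, C, hO, hC, hXOC⟩ := hX.1
  choose W hW hxW e P Q hP hQ hPQ using fun m => ht m x₀ hx₀
  have hWW : IsOpen[zariskiOn X] (U ∩ ⋂ m, W m) :=
    @IsOpen.inter _ (zariskiOn X) _ _ hU (@isOpen_iInter_of_finite _ _ (zariskiOn X) _ _ hW)
  obtain ⟨d₁, H₁, hH₁, hH₁x, hH₁W⟩ := isOpen_zariskiOn_iff.1 hWW x₀ ⟨hx₀, Set.mem_iInter.2 hxW⟩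
  have hx₀O : x₀.1 ∈ O := ((Set.ext_iff.1 hXOC x₀.1).1 x₀.2).1
  obtain ⟨d₂, H₂, hH₂, hH₂x, hH₂O⟩ := isOpen_projectiveZariski_iff.1 hO _ hx₀O
  obtain ⟨φ, hφ⟩ : ∃ φ : Module.Dual ℂ (Fin (n + 1) → ℂ), φ x₀.1.rep ≠ 0 := by
    by_contra! h
    exact x₀.1.rep_nonzero ((Module.forall_dual_apply_eq_zero_iff ℂ _).1 h)
  -- `H₁` cuts down to `U` and to the common domain of the fractions `P m / Q m`, `H₂` to the open
  -- part `O`. The linear factor excludes the origin, where `H₁` and `H₂` may be nonzero constants.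
  set H := H₁ * H₂ * MvPolynomial.X φ with hHdef
  have hH : H.IsHomogeneous (d₁ + d₂ + 1) := (hH₁.mul hH₂).mul (MvPolynomial.isHomogeneous_X ℂ φ)
  have hHval : ∀ v, polyEval H v = polyEval H₁ v * polyEval H₂ v * φ v := fun v => by
    rw [hHdef, polyEval_mul, polyEval_mul, polyEval_X]
  -- `S` is the principal open set `H ≠ 0` in the affine cone over `C`. It is an affine variety
  -- whose points represent points of `U`, so algebra homomorphisms to `ℂ` can be read as points.
  let S : Set (Fin (n + 1) → ℂ) := {v | polyEval H v ≠ 0 ∧ ∀ (r : ℕ) (F : MvPolynomial _ ℂ),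
    F.IsHomogeneous r → (∀ p ∈ C, polyEval F p.rep = 0) → polyEval F v = 0}
  have hS : ∀ v ∈ S, ∃ x : X, x ∈ U ∧ ∃ c : ℂ, c ≠ 0 ∧ x.1.rep = c • v := by
    rintro v ⟨hv1, hv2⟩
    have hv0 : v ≠ 0 := by
      rintro rfl
      exact hv1 (by rw [hHval, map_zero, mul_zero])
    have h1 : polyEval H (Projectivization.mk ℂ v hv0).rep ≠ 0 := by
      rwa [Ne, polyEval_rep_mk_eq_zero_iff hH]
    rw [hHval] at h1
    have h2 : Projectivization.mk ℂ v hv0 ∈ C := by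
      by_contra h
      obtain ⟨r, F, hF, h3, h4⟩ := isOpen_projectiveZariski_iff.1
        (@IsClosed.isOpen_compl _ (projectiveZariski _) _ hC) _ h
      refine h3 ((polyEval_rep_mk_eq_zero_iff hF hv0).2 (hv2 r F hF fun p hp => ?_))
      by_contra h5
      exact h4 p h5 hp
    have h3 := hH₂O _ (right_ne_zero_of_mul (left_ne_zero_of_mul h1))
    have h4 : Projectivization.mk ℂ v hv0 ∈ X := by
      rw [hXOC]
      exact ⟨h3, h2⟩
    exact ⟨⟨_, h4⟩, (hH₁W ⟨_, h4⟩ (left_ne_zero_of_mul (left_ne_zero_of_mul h1))).1,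
      exists_smul_eq_rep_mk v hv0⟩
  have hSX : ∀ x : X, polyEval H x.1.rep ≠ 0 → x.1.rep ∈ S := fun x hx =>
    ⟨hx, fun r F _ h => h x.1 ((Set.ext_iff.1 hXOC x.1).1 x.2).2⟩
  have hxval : ∀ x : X, polyEval H x.1.rep ≠ 0 → x ∈ U ∧ ∀ m, polyEval (Q m) x.1.rep ≠ 0 ∧
      t m x = polyEval (P m) x.1.rep / polyEval (Q m) x.1.rep := fun x hx => by
    rw [hHval] at hx
    have h1 := hH₁W x (left_ne_zero_of_mul (left_ne_zero_of_mul hx))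
    exact ⟨h1.1, fun m => hPQ m x ⟨Set.mem_iInter.1 h1.2 m, h1.1⟩⟩
  have hval : ∀ v ∈ S, ∃ x ∈ U, ∀ m, polyEval (Q m) v ≠ 0 ∧
      t m x = polyEval (P m) v / polyEval (Q m) v := fun v hv => by
    obtain ⟨x, hxU, c, hc, hx⟩ := hS v hv
    have h1 : polyEval H x.1.rep ≠ 0 := by
      rw [hx, polyEval_smul hH]
      exact mul_ne_zero (pow_ne_zero _ hc) hv.1
    refine ⟨x, hxU, fun m => ?_⟩
    obtain ⟨h2, h3⟩ := (hxval x h1).2 m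
    rw [hx, polyEval_smul (hQ m)] at h2
    rw [h3, hx, polyEval_smul (hQ m), polyEval_smul (hP m),
      mul_div_mul_left _ _ (pow_ne_zero _ hc)]
    exact ⟨right_ne_zero_of_mul h2, rfl⟩
  -- The coordinates, `1 / H` and the `1 / Q m` generate a finitely generated algebra of functions
  -- on `S` that contains the pullbacks of the `t m`.
  let gen : Set (S → ℂ) := Set.range (fun (i : Fin (n + 1)) (v : S) => v.1 i) ∪
    insert (fun v : S => (polyEval H v.1)⁻¹)
      (Set.range fun (m : Fin d) (v : S) => (polyEval (Q m) v.1)⁻¹)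
  have hgen : gen.Finite := (Set.finite_range _).union ((Set.finite_range _).insert _)
  have hft : Algebra.FiniteType ℂ (Algebra.adjoin ℂ gen) :=
    (Subalgebra.fg_iff_finiteType _).1 ⟨hgen.toFinset, by simp⟩
  have hpoly : ∀ F, (fun v : S => polyEval F v.1) ∈ Algebra.adjoin ℂ gen := fun F => by
    induction F using MvPolynomial.induction_on with
    | C c =>
      simp only [polyEval_C]
      exact (Algebra.adjoin ℂ gen).algebraMap_mem c
    | add p q hp hq =>
      simp only [polyEval_add]
      exact add_mem hp hq
    | mul_X p φ hp =>
      simp only [polyEval_mul, polyEval_X]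
      refine mul_mem hp ?_
      have h1 : (fun v : S => φ v.1) = ∑ i, φ (Pi.single i 1) • fun v : S => v.1 i := by
        funext v
        simp [(Pi.basisFun ℂ (Fin (n + 1))).dual_apply_eq_sum φ v.1]
      rw [h1]
      exact Subalgebra.sum_mem _ fun i _ => Subalgebra.smul_mem _
        (Algebra.subset_adjoin (s := gen) (Or.inl ⟨i, rfl⟩)) _
  let B := Algebra.adjoin ℂ gen
  let pB : MvPolynomial (Module.Dual ℂ (Fin (n + 1) → ℂ)) ℂ → B := fun F => ⟨_, hpoly F⟩
  let qB : Fin d → B := fun m =>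
    ⟨_, Algebra.subset_adjoin (s := gen) (Or.inr (Set.mem_insert_of_mem _ ⟨m, rfl⟩))⟩
  let hB : B := ⟨_, Algebra.subset_adjoin (s := gen) (Or.inr (Set.mem_insert _ _))⟩
  -- A relation in `B` holds where `H ≠ 0`, a nonempty open subset of the irreducible `X`, and hence
  -- on all of `U`.
  have hindB : AlgebraicIndependent ℂ fun m => pB (P m) * qB m := by
    rw [algebraicIndependent_iff]
    intro F hF
    refine algebraicIndependent_iff.1 hind F (regularFunctions_ext fun x => ?_)
    rw [map_zero, MvPolynomial.comp_aeval_apply, MvPolynomial.aeval_eq_eval]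
    refine IsRegularOn.eq_zero_of_isOpen hX.2 hU (IsRegularOn.eval_mvPolynomial ht F)
      (isOpen_zariskiOn_polyEval_ne_zero hH) ⟨x₀, ?_⟩ (fun y hy _ => ?_) x.2
    · change polyEval H x₀.1.rep ≠ 0
      rw [hHval]
      exact mul_ne_zero (mul_ne_zero hH₁x hH₂x) hφ
    · have h1 := congrArg ((Pi.evalAlgHom ℂ (fun _ : S => ℂ) ⟨y.1.rep, hSX y hy⟩).comp B.val) hF
      rw [map_zero, MvPolynomial.comp_aeval_apply, MvPolynomial.aeval_eq_eval] at h1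
      rw [← h1]
      congr 2
      funext m
      rw [((hxval y hy).2 m).2]
      rfl
  obtain ⟨F, hF, hext⟩ := exists_algHom_of_eval_ne_zero _ hindB
  refine ⟨F, hF, fun a ha => ?_⟩
  obtain ⟨ψ, hψ⟩ := hext a ha
  let v : Fin (n + 1) → ℂ := fun i => ψ (pB (MvPolynomial.X (LinearMap.proj i)))
  have hψv : ∀ F, ψ (pB F) = polyEval F v := fun F => by
    induction F using MvPolynomial.induction_on with
    | C c =>
      rw [polyEval_C, show pB (MvPolynomial.C c) = algebraMap ℂ B c from
        Subtype.ext (funext fun v => polyEval_C c v.1), AlgHom.commutes]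
      rfl
    | add p q hp hq =>
      rw [polyEval_add, ← hp, ← hq, ← map_add]
      exact congrArg ψ (Subtype.ext (funext fun v => polyEval_add p q v.1))
    | mul_X p φ hp =>
      rw [polyEval_mul, ← hp, polyEval_X, show pB (p * MvPolynomial.X φ) =
        pB p * pB (MvPolynomial.X φ) from Subtype.ext (funext fun v => polyEval_mul _ _ v.1),
        map_mul]
      congr 1
      have h1 : pB (MvPolynomial.X φ) =
          ∑ i, φ (Pi.single i 1) • pB (MvPolynomial.X (LinearMap.proj i)) := by
        refine Subtype.ext (funext fun v => ?_)
        rw [AddSubmonoidClass.coe_finsetSum, Finset.sum_apply]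
        change polyEval (MvPolynomial.X φ) v.1 =
          ∑ i, φ (Pi.single i 1) * polyEval (MvPolynomial.X (LinearMap.proj i)) v.1
        simp [(Pi.basisFun ℂ (Fin (n + 1))).dual_apply_eq_sum φ v.1]
      rw [h1, map_sum, (Pi.basisFun ℂ (Fin (n + 1))).dual_apply_eq_sum φ v]
      simp [v]
  -- `H` is invertible in `B`, and forms vanishing on `C` are zero in `B`; `ψ` carries both facts
  -- over to `v`.
  have hvS : v ∈ S := by
    refine ⟨fun h => ?_, fun r F hF h => ?_⟩
    · have h1 : pB H * hB = 1 := Subtype.ext (funext fun v => mul_inv_cancel₀ v.2.1)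
      have h2 := congrArg ψ h1
      rw [map_mul, hψv, h, zero_mul, map_one] at h2
      exact zero_ne_one h2
    · rw [← hψv, show pB F = 0 from Subtype.ext (funext fun v => v.2.2 r F hF h), map_zero]
  obtain ⟨x, hxU, hx⟩ := hval v hvS
  refine ⟨x, hxU, fun m => ?_⟩
  rw [(hx m).2, ← hψ m, map_mul, hψv, div_eq_mul_inv]
  congr 1
  have h1 : pB (Q m) * qB m = 1 := Subtype.ext (funext fun v => by
    obtain ⟨y, _, hy⟩ := hval v.1 v.2
    exact mul_inv_cancel₀ (hy m).1)
  have h2 := congrArg ψ h1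
  rw [map_mul, hψv, map_one] at h2
  exact (eq_inv_of_mul_eq_one_right h2).symm

/-! ### The dimension of the image of a Kodaira map -/

section

variable {V : Type*} [AddCommGroup V] [Module ℂ V] {X : Set (ℙ ℂ V)}

namespace LinearSeries

theorem isOpen_rep_ne_zero (E : LinearSeries X) (f : E.space)
    (Y : Set (ℙ ℂ (Module.Dual ℂ E.space))) : IsOpen[zariskiOn Y] {p : Y | p.1.rep f ≠ 0} := by
  have := isOpen_zariskiOn_polyEval_ne_zero (X := Y)
    (MvPolynomial.isHomogeneous_X ℂ (Module.Dual.eval ℂ E.space f))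
  simpa using this

theorem isRegularOn_eval_rep_div (E : LinearSeries X) (f : E.space)
    (Y : Set (ℙ ℂ (Module.Dual ℂ E.space))) {σ : Type*} (t : σ → E.space) (F : MvPolynomial σ ℂ) :
    IsRegularOn {p : Y | p.1.rep f ≠ 0}
      (fun p => MvPolynomial.eval (fun m => p.1.rep (t m) / p.1.rep f) F) := by
  refine IsRegularOn.eval_mvPolynomial (fun m => ?_) F
  have := isRegularOn_div_polyEval (X := Y) (U := {p : Y | p.1.rep f ≠ 0})
    (MvPolynomial.isHomogeneous_X ℂ (Module.Dual.eval ℂ E.space (t m)))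
    (MvPolynomial.isHomogeneous_X ℂ (Module.Dual.eval ℂ E.space f)) (by simp)
  simpa using this

/-- A basis of the sections already gives quotients whose closure contains all the others. The bound
serves to make ranks and dimensions finite. -/
theorem eRk_range_ratioOn_le (E : LinearSeries X) {f : E.space} {U : Set X}
    (hU : U ⊆ E.nonvanishing f) [IsDomain (regularFunctions U)] :
    (AlgebraicIndependent.matroid ℂ (regularFunctions U)).eRk (Set.range (E.ratioOn hU)) ≤
      Module.finrank ℂ E.space := by
  have := E.finiteDimensional
  let b := Module.finBasis ℂ E.space
  have h1 : Set.range (E.ratioOn hU) ⊆ (AlgebraicIndependent.matroid ℂ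
      (regularFunctions U)).closure (Set.range fun i => E.ratioOn hU (b i)) := by
    rintro _ ⟨s, rfl⟩
    rw [AlgebraicIndependent.matroid_closure_eq, ← b.sum_repr s, map_sum]
    refine sum_mem fun i _ => ?_
    rw [map_smul, Algebra.smul_def]
    refine mul_mem ?_ ?_
    · exact isAlgebraic_algebraMap (algebraMap ℂ (Algebra.adjoin ℂ
        (Set.range fun i => E.ratioOn hU (b i))) (b.repr s i))
    · exact isAlgebraic_algebraMap (⟨_, Algebra.subset_adjoin ⟨i, rfl⟩⟩ : Algebra.adjoin ℂ
        (Set.range fun i => E.ratioOn hU (b i)))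
  refine (Matroid.eRk_mono _ h1).trans ?_
  rw [Matroid.eRk_closure_eq]
  refine (Matroid.eRk_le_encard _ _).trans ?_
  rw [← Set.image_univ]
  refine (Set.encard_image_le _ _).trans ?_
  simp

/-- Chains of irreducible closed subsets of the image of the Kodaira map are not longer than the
transcendence degree of the quotients of sections. -/
theorem exists_forall_le_eRk_range_ratioOn (hX : @IsIrreducible _ (projectiveZariski V) X)
    (E : LinearSeries X) {m : ℕ}
    (hm : (m : WithBot ℕ∞) ≤ @topologicalKrullDim (Set.range E.kodaira) (zariskiOn _)) :
    ∃ x : X, ∀ (f : E.space), x ∈ E.nonvanishing f → ∀ (U : Set X) (_ : IsOpen[zariskiOn X] U)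
      (_ : U.Nonempty) (hU : U ⊆ E.nonvanishing f) [IsDomain (regularFunctions U)],
      (m : ℕ∞) ≤ (AlgebraicIndependent.matroid ℂ (regularFunctions U)).eRk
        (Set.range (E.ratioOn hU)) := by
  let := zariskiOn (Set.range E.kodaira)
  have := E.finiteDimensional
  obtain ⟨c, rfl⟩ := Order.le_krullDim_iff.1 hm
  -- A point of the smallest member lies in every member of the chain, so any chart `f ≠ 0`
  -- containing it meets them all. It is chosen before `f` and `U`, which leaves `f` free to serve
  -- several chains at once.
  obtain ⟨⟨_, x, rfl⟩, hx⟩ := c.head.isIrreducible.nonempty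
  refine ⟨x, fun f hf U hUo hne hU _ => ?_⟩
  set S := Set.range (E.ratioOn hU) with hS
  have hft : Algebra.FiniteType ℂ (Algebra.adjoin ℂ S) := by
    obtain ⟨s, hs⟩ := (Submodule.fg_iff_finiteDimensional (LinearMap.range (E.ratioOn hU))).2
      inferInstance
    refine (Subalgebra.fg_iff_finiteType _).1 ⟨s, ?_⟩
    rw [← Algebra.adjoin_span, hs, LinearMap.coe_range]
  let g : MvPolynomial E.space ℂ →ₐ[ℂ] Algebra.adjoin ℂ S :=
    MvPolynomial.aeval fun s => ⟨E.ratioOn hU s, Algebra.subset_adjoin ⟨s, rfl⟩⟩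
  have hgval : ∀ F, ((g F : Algebra.adjoin ℂ S) : regularFunctions U) =
      MvPolynomial.aeval (E.ratioOn hU) F := fun F =>
    MvPolynomial.comp_aeval_apply (φ := (Algebra.adjoin ℂ S).val) (p := F) ..
  have hgsurj : Function.Surjective g := by
    rintro ⟨r, hr⟩
    have hr' := hr
    rw [hS, Algebra.adjoin_range_eq_range_aeval] at hr'
    obtain ⟨p, hp⟩ := hr'
    exact ⟨p, Subtype.ext ((hgval p).trans hp)⟩
  let val : Set.range E.kodaira → MvPolynomial E.space ℂ →+* ℂ := fun p =>
    MvPolynomial.eval fun s => p.1.rep s / p.1.rep f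
  have hDo := E.isOpen_rep_ne_zero f (Set.range E.kodaira)
  have hopen : ∀ F, IsOpen {p : Set.range E.kodaira | p.1.rep f ≠ 0 ∧ val p F ≠ 0} := fun F =>
    (E.isRegularOn_eval_rep_div f (Set.range E.kodaira) id F).isOpen_ne_zero hDo
  -- The ideal of `Z` in the affine chart `f ≠ 0`, in variables standing for the quotients `s / f`.
  let q : TopologicalSpace.IrreducibleCloseds (Set.range E.kodaira) →
      Ideal (MvPolynomial E.space ℂ) := fun Z =>
    { carrier := {F | ∀ p ∈ Z, p.1.rep f ≠ 0 → val p F = 0}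
      add_mem' := fun hF hG p hp h => by rw [map_add, hF p hp h, hG p hp h, add_zero]
      zero_mem' := fun p _ _ => map_zero _
      smul_mem' := fun F G hG p hp h => by rw [smul_eq_mul, map_mul, hG p hp h, mul_zero] }
  have hmem : ∀ Z F, F ∈ q Z ↔ ∀ p ∈ Z, p.1.rep f ≠ 0 → val p F = 0 := fun _ _ => Iff.rfl
  have hxf : (E.kodaira x).rep f ≠ 0 := (E.rep_kodaira_ne_zero_iff f x).2 hf
  have hprime : ∀ i, (q (c i)).IsPrime := fun i => by
    have hxi : (⟨_, x, rfl⟩ : Set.range E.kodaira) ∈ c i := (LTSeries.head_le c i) hx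
    refine ⟨(Ideal.ne_top_iff_one _).2 fun h => ?_, fun {F G} hFG => ?_⟩
    · have := h _ hxi hxf
      rw [map_one] at this
      exact one_ne_zero this
    · by_contra! hcon
      simp only [hmem, not_forall] at hcon
      obtain ⟨⟨p, hp, hpf, hpF⟩, p', hp', hpf', hpG⟩ := hcon
      obtain ⟨r, hr, ⟨h1, h2⟩, -, h3⟩ := (c i).isIrreducible.2 _ _ (hopen F) (hopen G)
        ⟨p, hp, hpf, hpF⟩ ⟨p', hp', hpf', hpG⟩
      have := hFG r hr h1
      rw [map_mul] at this
      exact mul_ne_zero h2 h3 this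
  -- A relation between the quotients on `U` extends by irreducibility to the whole locus `f ≠ 0`,
  -- so the ideals `q Z` descend to the algebra generated by the quotients.
  have hker : ∀ Z, RingHom.ker (g : MvPolynomial E.space ℂ →+* Algebra.adjoin ℂ S) ≤ q Z := by
    rintro Z F hF ⟨_, y, rfl⟩ - hyf
    have hy := (E.rep_kodaira_ne_zero_iff f y).1 hyf
    have h1 : val ⟨_, y, rfl⟩ F = MvPolynomial.eval (fun s => E.ratio f s y) F := by
      simp only [val, rep_kodaira_div]
    rw [h1]
    refine IsRegularOn.eq_zero_of_isOpen hX (E.isOpen_nonvanishing f)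
      (IsRegularOn.eval_mvPolynomial (fun s => E.isRegularOn_ratio f s) F) hUo hne
      (fun z hz _ => ?_) hy
    have h2 := hgval F
    rw [show g F = 0 from hF] at h2
    have h3 := congrArg (evalRegular ⟨z, hz⟩) h2
    rw [MvPolynomial.comp_aeval_apply, MvPolynomial.aeval_eq_eval] at h3
    exact h3.symm.trans (map_zero _)
  have hanti : ∀ i j, i < j → q (c j) < q (c i) := fun i j hij => by
    have hlt : c i < c j := c.strictMono hij
    refine lt_of_le_of_ne (fun F hF p hp => hF p (hlt.le hp)) fun heq => ?_
    obtain ⟨y, hy, hyi⟩ := Set.exists_of_ssubset (SetLike.coe_ssubset_coe.2 hlt)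
    obtain ⟨d, F, hF, h1, h2⟩ := isOpen_zariskiOn_iff.1 (c i).isClosed.isOpen_compl y hyi
    -- Linear forms on `E*` are evaluations at sections, so a homogeneous `F` separating two members
    -- of the chain can be dehomogenised into a polynomial in the `s / f`.
    let e := Module.evalEquiv ℂ E.space
    have hev : ∀ p : Set.range E.kodaira, p.1.rep f ≠ 0 → polyEval F p.1.rep =
        p.1.rep f ^ d * val p (MvPolynomial.rename e.symm F) := fun p hp => by
      have h3 : p.1.rep = p.1.rep f • ((p.1.rep f)⁻¹ • p.1.rep) := by
        rw [smul_smul, mul_inv_cancel₀ hp, one_smul]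
      conv_lhs => rw [h3, polyEval_smul hF]
      congr 1
      simp only [val, MvPolynomial.eval_rename, polyEval]
      congr 2
      funext φ
      obtain ⟨s, rfl⟩ := e.surjective φ
      simp [e, div_eq_inv_mul]
    have hxj : (⟨_, x, rfl⟩ : Set.range E.kodaira) ∈ c j := (LTSeries.head_le c j) hx
    obtain ⟨z, hz, hzf, hzF⟩ := (c j).isIrreducible.2 _ _ hDo
      (isOpen_zariskiOn_polyEval_ne_zero hF) ⟨_, hxj, hxf⟩ ⟨y, hy, h1⟩
    have h4 : MvPolynomial.rename e.symm F ∈ q (c i) := fun p hp hpf => by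
      by_contra h5
      exact h2 p (by rw [hev p hpf]; exact mul_ne_zero (pow_ne_zero _ hpf) h5) hp
    rw [← heq] at h4
    exact hzF (by rw [hev z hzf, h4 z hz hzf, mul_zero])
  refine le_eRk_of_strictAnti_primeSpectrum S
    (fun i => ⟨(q (c i)).map (g : MvPolynomial E.space ℂ →+* Algebra.adjoin ℂ S),
      Ideal.map_isPrime_of_surjective (H := hprime i) hgsurj (hker _)⟩) fun i j hij => ?_
  have hback : ∀ i, ((q (c i)).map (g : MvPolynomial E.space ℂ →+* Algebra.adjoin ℂ S)).comap
      (g : MvPolynomial E.space ℂ →+* Algebra.adjoin ℂ S) = q (c i) := fun i => by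
    refine (Ideal.comap_map_of_surjective
      (g : MvPolynomial E.space ℂ →+* Algebra.adjoin ℂ S) hgsurj _).trans ?_
    exact sup_eq_left.2 (hker _)
  refine lt_of_le_of_ne (Ideal.map_mono (hanti i j hij).le) fun h => ?_
  have h1 := congrArg (fun p => p.asIdeal.comap (g : MvPolynomial E.space ℂ →+* Algebra.adjoin ℂ S)) h
  simp only [hback] at h1
  exact (hanti i j hij).ne h1

end LinearSeries

end

/-- Independent quotients `t m / f` are affine coordinates on the chart `f ≠ 0` of the Kodaira
image. Their values fill a nonempty principal open subset of `ℂ ^ d`, which forces dimension at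
least `d`. -/
theorem LinearSeries.le_topologicalKrullDim_range_kodaira {n : ℕ} {X : Set (ℙ ℂ (Fin (n + 1) → ℂ))}
    (hX : IsIrredQuasiProjective X) (E : LinearSeries X) {f : E.space} {U : Set X}
    (hUo : IsOpen[zariskiOn X] U) (hne : U.Nonempty) (hU : U ⊆ E.nonvanishing f)
    [IsDomain (regularFunctions U)] {d : ℕ}
    (hd : (d : ℕ∞) ≤ (AlgebraicIndependent.matroid ℂ (regularFunctions U)).eRk
      (Set.range (E.ratioOn hU))) :
    (d : WithBot ℕ∞) ≤ @topologicalKrullDim (Set.range E.kodaira) (zariskiOn _) := by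
  have := E.finiteDimensional
  obtain ⟨I, hIS, hI, hId⟩ := Matroid.le_eRk_iff.1 hd
  have hfin : I.Finite := Set.finite_of_encard_eq_coe hId
  have := hfin.to_subtype
  let e : I ≃ Fin d := Finite.equivFinOfCardEq (by
    rw [Nat.card_coe_set_eq, Set.ncard, hId]; rfl)
  choose t ht using fun m => hIS (e.symm m).2
  have hind : AlgebraicIndependent ℂ fun m => E.ratioOn hU (t m) := by
    have := AlgebraicIndependent.comp hI e.symm e.symm.injective
    simpa [ht, Function.comp_def] using this
  obtain ⟨F₀, hF₀, himg⟩ := exists_forall_eval_ne_zero_mem_image hX hUo hne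
    (fun m => E.ratio f (t m)) (fun m => (E.isRegularOn_ratio f (t m)).mono hU) hind
  let := zariskiOn (Set.range E.kodaira)
  let W : Set (Set.range E.kodaira) := {p | p.1.rep f ≠ 0}
  have : TopologicalSpace.NoetherianSpace W := by
    let := projectiveZariski (Module.Dual ℂ E.space)
    have := noetherianSpace_projectiveZariski (V := Module.Dual ℂ E.space)
    have h1 : Topology.IsInducing (fun p : W => p.1.1) :=
      (Topology.IsInducing.subtypeVal (t := Set.range E.kodaira)).comp
        (Topology.IsInducing.subtypeVal (t := W))
    exact h1.noetherianSpace
  refine le_trans ?_ (topologicalKrullDim_subspace_le _ W)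
  refine le_topologicalKrullDim_of_eval_ne_zero d
    (fun w m => w.1.1.rep (t m) / w.1.1.rep f) (fun F => ?_) F₀ hF₀ fun a ha => ?_
  · have h1 := ((E.isRegularOn_eval_rep_div f (Set.range E.kodaira) t F).isOpen_ne_zero
      (E.isOpen_rep_ne_zero f _)).preimage (continuous_subtype_val (p := fun p => p ∈ W))
    convert h1 using 1
    ext w
    exact ⟨fun h => ⟨w.2, h⟩, fun h => h.2⟩
  · obtain ⟨x, hx, hxa⟩ := himg a ha
    refine ⟨⟨⟨_, x, rfl⟩, (E.rep_kodaira_ne_zero_iff f x).2 (hU hx)⟩, funext fun m => ?_⟩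
    simp only [LinearSeries.rep_kodaira_div, hxa]

section

variable {V : Type*} [AddCommGroup V] [Module ℂ V] {X : Set (ℙ ℂ V)}

namespace LinearSeries

theorem exists_mem_nonvanishing (E : LinearSeries X) (x : X) : ∃ f, x ∈ E.nonvanishing f := by
  by_contra! h
  exact E.valueAt_ne_zero x (LinearMap.ext fun f => not_not.1 (h f))

/-- A complex vector space is not a finite union of proper subspaces. -/
theorem exists_forall_mem_nonvanishing (E : LinearSeries X) {ι : Type*} [Finite ι] (x : ι → X) :
    ∃ f, ∀ i, x i ∈ E.nonvanishing f := by
  obtain ⟨f, hf⟩ := Module.Dual.exists_forall_ne_zero_of_forall_exists (fun i => E.valueAt (x i))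
    fun i => E.exists_mem_nonvanishing (x i)
  exact ⟨f, hf⟩

/-- The default values in `zariskiDim` never intervene here: the Krull dimension is nonnegative and
at most the dimension of the space of sections. -/
theorem natCast_zariskiDim_range_kodaira (hX : @IsIrreducible _ (projectiveZariski V) X)
    (E : LinearSeries X) : (zariskiDim (Set.range E.kodaira) : WithBot ℕ∞) =
      @topologicalKrullDim (Set.range E.kodaira) (zariskiOn _) := by
  have hbound : ∀ m : ℕ, (m : WithBot ℕ∞) ≤
      @topologicalKrullDim (Set.range E.kodaira) (zariskiOn _) → m ≤ Module.finrank ℂ E.space := by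
    intro m hm
    obtain ⟨x, hx⟩ := E.exists_forall_le_eRk_range_ratioOn hX hm
    obtain ⟨f, hf⟩ := E.exists_mem_nonvanishing x
    have := isDomain_regularFunctions hX (E.isOpen_nonvanishing f) ⟨x, hf⟩
    exact_mod_cast (hx f hf _ (E.isOpen_nonvanishing f) ⟨x, hf⟩ subset_rfl).trans
      (E.eRk_range_ratioOn_le subset_rfl)
  have hnonneg : 0 ≤ @topologicalKrullDim (Set.range E.kodaira) (zariskiOn _) := by
    let := zariskiOn (Set.range E.kodaira)
    obtain ⟨x, hx⟩ := hX.1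
    have : Nonempty (TopologicalSpace.IrreducibleCloseds (Set.range E.kodaira)) :=
      ⟨⟨closure {⟨_, ⟨x, hx⟩, rfl⟩}, isIrreducible_singleton.closure, isClosed_closure⟩⟩
    exact Order.krullDim_nonneg
  unfold zariskiDim
  generalize @topologicalKrullDim (Set.range E.kodaira) (zariskiOn _) = D at hbound hnonneg
  induction D with
  | bot => simp at hnonneg
  | coe D =>
    induction D with
    | top =>
      have := hbound (Module.finrank ℂ E.space + 1) (by exact le_top)
      omega
    | coe D => simp

theorem exists_forall_zariskiDim_le (hX : @IsIrreducible _ (projectiveZariski V) X)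
    (E : LinearSeries X) : ∃ x : X, ∀ (f : E.space), x ∈ E.nonvanishing f →
      ∀ (U : Set X) (_ : IsOpen[zariskiOn X] U) (_ : U.Nonempty) (hU : U ⊆ E.nonvanishing f)
        [IsDomain (regularFunctions U)], (zariskiDim (Set.range E.kodaira) : ℕ∞) ≤
          (AlgebraicIndependent.matroid ℂ (regularFunctions U)).eRk (Set.range (E.ratioOn hU)) :=
  E.exists_forall_le_eRk_range_ratioOn hX (E.natCast_zariskiDim_range_kodaira hX).le

/-! ### Products of linear series -/

variable {κ : Type} [Fintype κ] (E : κ → LinearSeries X)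

/-- The products of sections of the given linear series. -/
def tensorSections : Set ((LineBundle.tensor fun i => (E i).bundle).ι → X → ℂ) :=
  {t | ∃ s : ∀ i, (E i).bundle.ι → X → ℂ, (∀ i, s i ∈ (E i).space) ∧
    t = LineBundle.tensorSection (fun i => (E i).bundle) s}

/-- The product of sections, as an element of the product of the linear series. -/
def prodSection (s : ∀ i, (E i).space) : (LinearSeries.prod E).space :=
  ⟨LineBundle.tensorSection (fun i => (E i).bundle) fun i => (s i).1, by
    have h : LineBundle.tensorSection (fun i => (E i).bundle) (fun i => (s i).1) ∈
        Submodule.span ℂ (tensorSections E) :=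
      Submodule.subset_span ⟨_, fun i => (s i).2, rfl⟩
    exact h⟩

theorem span_range_prodSection : Submodule.span ℂ (Set.range (prodSection E)) = ⊤ := by
  have h : Submodule.span ℂ (Subtype.val ⁻¹' tensorSections E :
      Set (Submodule.span ℂ (tensorSections E))) = ⊤ := Submodule.span_span_coe_preimage
  have h' : Subtype.val ⁻¹' tensorSections E = (Set.range (prodSection E) :
      Set (Submodule.span ℂ (tensorSections E))) := by
    ext ⟨t, ht⟩
    constructor
    · rintro ⟨s, hs, rfl⟩
      exact ⟨fun i => ⟨s i, hs i⟩, rfl⟩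
    · rintro ⟨s, hs⟩
      exact ⟨fun i => s i, fun i => (s i).2, (congrArg Subtype.val hs).symm⟩
  rw [h'] at h
  exact h

theorem mem_nonvanishing_prodSection_iff (f : ∀ i, (E i).space) (x : X) :
    x ∈ (LinearSeries.prod E).nonvanishing (prodSection E f) ↔
      ∀ i, x ∈ (E i).nonvanishing (f i) := by
  choose a ha using fun i => (E i).bundle.covers x
  rw [(LinearSeries.prod E).mem_nonvanishing_iff (a := a) _ (Set.mem_iInter.2 ha)]
  simp only [(E _).mem_nonvanishing_iff _ (ha _)]
  exact Finset.prod_ne_zero_iff.trans (by simp)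

theorem ratio_prodSection (f s : ∀ i, (E i).space) (x : X) :
    (LinearSeries.prod E).ratio (prodSection E f) (prodSection E s) x =
      ∏ i, (E i).ratio (f i) (s i) x := by
  choose a ha using fun i => (E i).bundle.covers x
  rw [(LinearSeries.prod E).ratio_eq (a := a) _ _ (Set.mem_iInter.2 ha),
    Finset.prod_congr rfl fun i _ => (E i).ratio_eq (f i) (s i) (ha i), Finset.prod_div_distrib]
  rfl

/-- Quotients of products are products of quotients. Conversely, replacing a single factor of `∏ f
i` by `s` gives exactly `s / f i`. -/
theorem eRk_range_ratioOn_prodSection (f : ∀ i, (E i).space) {U : Set X}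
    (hU : ∀ i, U ⊆ (E i).nonvanishing (f i))
    (hU' : U ⊆ (LinearSeries.prod E).nonvanishing (prodSection E f))
    [IsDomain (regularFunctions U)] :
    (AlgebraicIndependent.matroid ℂ (regularFunctions U)).eRk
        (Set.range ((LinearSeries.prod E).ratioOn hU')) =
      (AlgebraicIndependent.matroid ℂ (regularFunctions U)).eRk
        (⋃ i, Set.range ((E i).ratioOn (hU i))) := by
  classical
  have hprod : ∀ s : ∀ i, (E i).space, (LinearSeries.prod E).ratioOn hU' (prodSection E s) =
      ∏ i, (E i).ratioOn (hU i) (s i) := fun s => regularFunctions_ext fun x => by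
    rw [map_prod]
    exact ratio_prodSection E f s x
  apply le_antisymm
  · rw [← Matroid.eRk_closure_eq (X := ⋃ i, Set.range ((E i).ratioOn (hU i)))]
    refine Matroid.eRk_mono _ ?_
    rw [AlgebraicIndependent.matroid_closure_eq]
    set A := Algebra.adjoin ℂ (⋃ i, Set.range ((E i).ratioOn (hU i)))
    have hA : ⊤ ≤ (Subalgebra.toSubmodule A).comap ((LinearSeries.prod E).ratioOn hU') := by
      rw [← span_range_prodSection, Submodule.span_le]
      rintro _ ⟨s, rfl⟩
      change (LinearSeries.prod E).ratioOn hU' (prodSection E s) ∈ A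
      rw [hprod]
      exact prod_mem fun i _ => Algebra.subset_adjoin (Set.mem_iUnion.2 ⟨i, _, rfl⟩)
    rintro _ ⟨t, rfl⟩
    exact isAlgebraic_algebraMap (⟨_, hA (Submodule.mem_top (x := t))⟩ : A)
  · refine Matroid.eRk_mono _ (Set.iUnion_subset fun i => ?_)
    rintro _ ⟨s, rfl⟩
    refine ⟨prodSection E (Function.update f i s), ?_⟩
    rw [hprod, Finset.prod_eq_single i]
    · rw [Function.update_self]
    · intro j _ hj
      rw [Function.update_of_ne hj, ratioOn_self]
    · simp

end LinearSeries

end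

theorem LinearSeries.eRk_range_ratioOn_le_zariskiDim {n : ℕ} {X : Set (ℙ ℂ (Fin (n + 1) → ℂ))}
    (hX : IsIrredQuasiProjective X) (E : LinearSeries X) {f : E.space} {U : Set X}
    (hUo : IsOpen[zariskiOn X] U) (hne : U.Nonempty) (hU : U ⊆ E.nonvanishing f)
    [IsDomain (regularFunctions U)] :
    (AlgebraicIndependent.matroid ℂ (regularFunctions U)).eRk (Set.range (E.ratioOn hU)) ≤
      zariskiDim (Set.range E.kodaira) := by
  obtain ⟨d, hd⟩ := ENat.ne_top_iff_exists.1
    ((E.eRk_range_ratioOn_le hU).trans_lt (ENat.natCast_lt_top _)).ne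
  have h := E.le_topologicalKrullDim_range_kodaira hX hUo hne hU hd.le
  rw [← E.natCast_zariskiDim_range_kodaira hX.2] at h
  rw [← hd]
  exact_mod_cast h

/-! ### Generic sections outside an essential subcollection -/

/-- `h` together with a basis `B₀` of `B` attains full rank, so it is independent, and `h` is
independent over `K[B₀]`. Passing to the algebraic closure of `K[B₀]` in `O` keeps this and makes
the algebra contain all of `B`. -/
theorem AlgebraicIndependent.exists_of_eRk_add_card_le {K O ι : Type*} [Field K] [CommRing O]
    [IsDomain O] [Algebra K O] [Fintype ι] {B : Set O}
    (hB : (AlgebraicIndependent.matroid K O).IsRkFinite B) (h : ι → O)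
    (hle : (AlgebraicIndependent.matroid K O).eRk B + Fintype.card ι ≤
      (AlgebraicIndependent.matroid K O).eRk (B ∪ Set.range h)) :
    ∃ A : Subalgebra K O, B ⊆ A ∧ AlgebraicIndependent A h := by
  obtain ⟨B₀, hB₀, hfin⟩ := hB.exists_finite_isBasis'
  refine ⟨(Subalgebra.algebraicClosure (Algebra.adjoin K B₀) O).restrictScalars K, ?_, ?_⟩
  · rw [Subalgebra.coe_restrictScalars, ← AlgebraicIndependent.matroid_closure_eq, hB₀.closure_eq_closure]
    exact Matroid.subset_closure _ _ (Set.subset_univ _)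
  · have := hfin.fintype
    let v : ι ⊕ B₀ → O := Sum.elim h (fun b : B₀ => b.1)
    have hrange : Set.range v = B₀ ∪ Set.range h := by
      rw [Set.Sum.elim_range, Subtype.range_coe, Set.union_comm]
    have h1 : (Set.univ : Set (ι ⊕ B₀)).encard ≤
        (AlgebraicIndependent.matroid K O).eRk (Set.range v) := by
      rw [hrange, hB₀.eRk_eq_eRk_union]
      refine le_trans (le_of_eq ?_) hle
      rw [← hB₀.encard_eq_eRk, Set.encard_univ, ENat.card_eq_coe_fintype_card, Fintype.card_sum,
        Set.encard_eq_coe_toFinset_card, Set.toFinset_card]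
      push_cast
      rw [add_comm]
    have h2 : (Set.range v).encard ≤ (Set.univ : Set (ι ⊕ B₀)).encard := by
      rw [← Set.image_univ]
      exact Set.encard_image_le _ _
    -- The rank of the range of `v` is at least the number of indices, so no two entries coincide.
    have hinj : Function.Injective v := by
      rw [← Set.injOn_univ]
      refine Set.finite_univ.injOn_of_encard_image_eq (le_antisymm (Set.encard_image_le _ _) ?_)
      rw [Set.image_univ]
      exact h1.trans (Matroid.eRk_le_encard _ _)
    have hind : AlgebraicIndependent K v := by
      rw [← algebraicIndependent_subtype_range hinj]
      refine (Matroid.indep_iff_eRk_eq_encard_of_finite (M := AlgebraicIndependent.matroid K O)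
        (Set.finite_range v)).2 (le_antisymm (Matroid.eRk_le_encard _ _) (h2.trans h1))
    have h3 := (AlgebraicIndependent.sumElim_iff.1 hind).2
    rw [Subtype.range_coe] at h3
    exact h3.subalgebraAlgebraicClosure

/-! ### Evaluation along affine families -/

section

variable {W : Type*} [AddCommGroup W] [Module ℂ W] {κ : Type*} [Fintype κ]

/-- The value of a polynomial on `W` at the point `p₀ + z p₁ - ∑ yᵢ wᵢ`, where `z` and the `yᵢ` are
elements of a commutative algebra. -/
noncomputable def evalAffine {R : Type*} [CommRing R] [Algebra ℂ R] (p₀ p₁ : W) (w : κ → W) (z : R)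
    (y : κ → R) : MvPolynomial (Module.Dual ℂ W) ℂ →ₐ[ℂ] R :=
  MvPolynomial.aeval fun φ =>
    algebraMap ℂ R (φ p₀) + algebraMap ℂ R (φ p₁) * z - ∑ i, algebraMap ℂ R (φ (w i)) * y i

theorem map_evalAffine {R R' : Type*} [CommRing R] [Algebra ℂ R] [CommRing R'] [Algebra ℂ R']
    (θ : R →+* R') (hθ : ∀ c, θ (algebraMap ℂ R c) = algebraMap ℂ R' c) (p₀ p₁ : W) (w : κ → W)
    (z : R) (y : κ → R) (G : MvPolynomial (Module.Dual ℂ W) ℂ) :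
    θ (evalAffine p₀ p₁ w z y G) = evalAffine p₀ p₁ w (θ z) (fun i => θ (y i)) G := by
  let θ' : R →ₐ[ℂ] R' := { θ with commutes' := hθ }
  change θ' _ = _
  rw [evalAffine, MvPolynomial.comp_aeval_apply, evalAffine]
  congr 2
  funext φ
  simp only [map_sub, map_add, map_mul, map_sum, AlgHom.commutes]
  rfl

theorem evalAffine_complex (p₀ p₁ : W) (w : κ → W) (z : ℂ) (y : κ → ℂ)
    (G : MvPolynomial (Module.Dual ℂ W) ℂ) :
    evalAffine p₀ p₁ w z y G = polyEval G (p₀ + z • p₁ - ∑ i, y i • w i) := by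
  rw [evalAffine, polyEval, MvPolynomial.aeval_eq_eval]
  congr 2
  funext φ
  simp [mul_comm]

/-- Pulling back a polynomial along an affine map. -/
theorem exists_polyEval_comp {W' : Type*} [AddCommGroup W'] [Module ℂ W'] (l : W' →ₗ[ℂ] W) (w₀ : W)
    (G : MvPolynomial (Module.Dual ℂ W) ℂ) :
    ∃ G' : MvPolynomial (Module.Dual ℂ W') ℂ, ∀ v, polyEval G' v = polyEval G (w₀ + l v) := by
  refine ⟨MvPolynomial.aeval (fun φ => MvPolynomial.C (φ w₀) + MvPolynomial.X (φ ∘ₗ l)) G,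
    fun v => ?_⟩
  rw [polyEval, ← MvPolynomial.aeval_eq_eval, MvPolynomial.comp_aeval_apply,
    MvPolynomial.aeval_eq_eval, polyEval]
  congr 2
  funext φ
  simp

end

/-- If a polynomial vanishes at `p₀ + ζ p₁ - ∑ yᵢ wᵢ` for all values of `yᵢ = uᵢ` (`i ∈ J`) and
`yᵢ = hᵢ + ζ eᵢ` (`i ∉ J`), where the `hᵢ` are algebraically independent over an algebra that
contains the `uᵢ`, then the `yᵢ` for `i ∉ J` may be replaced by arbitrary numbers, such as zero. -/
theorem polyEval_eq_zero_of_algebraicIndependent {W : Type*} [AddCommGroup W] [Module ℂ W]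
    {κ : Type*} [Fintype κ] [DecidableEq κ] {J : Finset κ} {A O σ : Type*} [CommRing A]
    [CommRing O] [IsDomain O] [Algebra ℂ A] [Algebra ℂ O] [Algebra A O] [IsScalarTower ℂ A O]
    (ev : σ → O →ₐ[ℂ] ℂ) (hev : ∀ p, (∀ x, ev x p = 0) → p = 0) (u : κ → A) (h e : κ → O)
    (hh : AlgebraicIndependent A fun i : {i // i ∉ J} => h i) (p₀ p₁ : W) (w : κ → W)
    (G : MvPolynomial (Module.Dual ℂ W) ℂ)
    (hG : ∀ (ζ : ℂ) (x : σ), polyEval G (p₀ + ζ • p₁ - ∑ i,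
      (if i ∈ J then ev x (algebraMap A O (u i)) else ev x (h i) + ζ * ev x (e i)) • w i) = 0)
    (x : σ) :
    polyEval G (p₀ + p₁ - ∑ i, (if i ∈ J then ev x (algebraMap A O (u i)) else 0) • w i) = 0 := by
  let y : κ → Polynomial (MvPolynomial {i // i ∉ J} A) := fun i =>
    if h : i ∈ J then Polynomial.C (MvPolynomial.C (u i))
    else Polynomial.C (MvPolynomial.X ⟨i, h⟩)
  -- The universal value of `G`: `ζ` becomes `X`, and each coefficient outside `J` a free variable.
  -- `Φ` substitutes `h i + X e i` for these variables.
  let Q : Polynomial (MvPolynomial {i // i ∉ J} A) := evalAffine p₀ p₁ w Polynomial.X y G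
  let Φ : Polynomial (MvPolynomial {i // i ∉ J} A) →+* Polynomial O := Polynomial.eval₂RingHom
      (MvPolynomial.eval₂Hom (Polynomial.C.comp (algebraMap A O))
        (fun i : {i // i ∉ J} => (Polynomial.C (h i) + Polynomial.X * Polynomial.C (e i) :
          Polynomial O))) Polynomial.X
  have hΦinj : Function.Injective Φ := hh.eval₂_add_X_mul_injective fun i => e i
  have halg : ∀ c : ℂ, algebraMap ℂ (Polynomial (MvPolynomial {i // i ∉ J} A)) c =
      Polynomial.C (MvPolynomial.C (algebraMap ℂ A c)) := fun c => rfl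
  have hΦ : ∀ (ζ : ℂ) (x : σ), ev x ((Φ Q).eval (algebraMap ℂ O ζ)) = 0 := by
    intro ζ x
    let θ : Polynomial (MvPolynomial {i // i ∉ J} A) →+* ℂ := ((ev x : O →ₐ[ℂ] ℂ) : O →+* ℂ).comp
      ((Polynomial.evalRingHom (algebraMap ℂ O ζ)).comp Φ)
    have hθ : ∀ c, θ (algebraMap ℂ (Polynomial (MvPolynomial {i // i ∉ J} A)) c) = algebraMap ℂ ℂ c := fun c => by
      rw [halg]
      simp [θ, Φ, ← IsScalarTower.algebraMap_apply]
    change θ Q = 0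
    rw [map_evalAffine θ hθ, evalAffine_complex]
    refine Eq.trans ?_ (hG ζ x)
    have hθX : θ Polynomial.X = ζ := by simp [θ, Φ]
    rw [hθX]
    congr 2
    refine Finset.sum_congr rfl fun i _ => ?_
    congr 1
    by_cases hi : i ∈ J
    · simp [θ, Φ, y, hi]
    · simp [θ, Φ, y, hi]
      ring
  -- Over the domain `O`, the polynomial `Φ Q` has every complex number as a root, so it is zero,
  -- and `Φ` is injective.
  have hQ : Q = 0 := by
    refine hΦinj ?_
    rw [map_zero]
    refine Polynomial.eq_zero_of_infinite_isRoot _ ?_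
    refine (Set.infinite_range_of_injective (algebraMap ℂ O).injective).mono ?_
    rintro _ ⟨ζ, rfl⟩
    exact hev _ fun x => hΦ ζ x
  -- Specialise the identity `Q = 0` at `X = 1`, with the free variables equal to `0` and the
  -- coefficients in `A` evaluated at `x`.
  let θ : Polynomial (MvPolynomial {i // i ∉ J} A) →+* ℂ := Polynomial.eval₂RingHom
    (MvPolynomial.eval₂Hom (((ev x : O →ₐ[ℂ] ℂ) : O →+* ℂ).comp (algebraMap A O)) fun _ => 0) 1
  have hθ : ∀ c, θ (algebraMap ℂ (Polynomial (MvPolynomial {i // i ∉ J} A)) c) = algebraMap ℂ ℂ c := fun c => by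
    rw [halg]
    simp [θ, ← IsScalarTower.algebraMap_apply]
  have h1 : θ Q = 0 := by rw [hQ, map_zero]
  rw [map_evalAffine θ hθ, evalAffine_complex] at h1
  rw [show θ Polynomial.X = 1 by simp [θ], one_smul] at h1
  refine Eq.trans ?_ h1
  congr 2
  refine Finset.sum_congr rfl fun i _ => ?_
  congr 1
  by_cases hi : i ∈ J
  · simp [θ, y, hi]
  · simp [θ, y, hi]

section

variable {V : Type*} [AddCommGroup V] [Module ℂ V] {X : Set (ℙ ℂ V)}

/-- If the quotients `b i / f i` for `i ∉ J` are algebraically independent over an algebra which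
contains the quotients `s / f i` for `i ∈ J`, then a polynomial that vanishes on all systems with
a common root vanishes on all systems for which the equations in `J` have a common root. -/
theorem polyEval_eq_zero_of_forall_incidenceVariety {κ : Type} [Fintype κ] [DecidableEq κ]
    (E : κ → LinearSeries X) (f : ∀ i, (E i).space) {U : Set X}
    (hU : ∀ i, U ⊆ (E i).nonvanishing (f i)) [IsDomain (regularFunctions U)] (J : Finset κ)
    (A : Subalgebra ℂ (regularFunctions U)) (hA : ∀ i ∈ J, ∀ s, (E i).ratioOn (hU i) s ∈ A)
    (b : ∀ i, (E i).space)
    (hb : AlgebraicIndependent A fun i : {i // i ∉ J} => (E i).ratioOn (hU i) (b i))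
    (G : MvPolynomial (Module.Dual ℂ (∀ i, (E i).space)) ℂ)
    (hG : ∀ q ∈ incidenceVariety E, polyEval G q.2 = 0) {x : X} (hx : x ∈ U)
    (s : ∀ i, (E i).space) (hs : ∀ i ∈ J, (E i).valueAt x (s i) = 0) : polyEval G s = 0 := by
  have hwsum : ∀ (y : κ → ℂ) (i : κ),
      (∑ j, y j • (Pi.single j (f j) : ∀ i, (E i).space)) i = y i • f i := fun y i => by
    rw [Finset.sum_apply, Finset.sum_eq_single i]
    · simp
    · intro j _ hj
      simp [Pi.single_eq_of_ne hj.symm]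
    · simp
  let u : κ → A := fun i => if hi : i ∈ J then ⟨_, hA i hi (s i)⟩ else 0
  have hu : ∀ i ∈ J, algebraMap A (regularFunctions U) (u i) = (E i).ratioOn (hU i) (s i) :=
    fun i hi => by
      simp only [u, hi, dif_pos]
      rfl
  -- Outside `J` the line from `b i` to `s i` is used, because the `s i / f i` themselves need not
  -- be independent. Subtracting from each section its value relative to `f i` at `x'` makes `x'` a
  -- root of the system.
  have key := polyEval_eq_zero_of_algebraicIndependent (J := J)
    (fun x : U => evalRegular x) (fun p hp => regularFunctions_ext fun x => by rw [hp, map_zero])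
    u (fun i => (E i).ratioOn (hU i) (b i)) (fun i => (E i).ratioOn (hU i) (s i - b i)) hb
    (fun i => if i ∈ J then s i else b i) (fun i => if i ∈ J then 0 else s i - b i)
    (fun i => Pi.single i (f i)) G (fun ζ x' => by
      refine hG (x'.1, _) fun i => ?_
      rw [LinearSeries.vanishes_iff_valueAt]
      have hfx : (E i).valueAt x'.1 (f i) ≠ 0 := hU i x'.2
      dsimp only
      rw [Pi.sub_apply, Pi.add_apply, Pi.smul_apply, hwsum]
      by_cases hi : i ∈ J
      · simp only [hi, if_true, hu i hi, LinearSeries.evalRegular_ratioOn, LinearSeries.ratio,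
          smul_zero, add_zero, map_sub, map_smul, smul_eq_mul]
        field_simp
        ring
      · simp only [hi, if_false, LinearSeries.evalRegular_ratioOn, LinearSeries.ratio,
          map_sub, map_add, map_smul, smul_eq_mul]
        field_simp
        ring) ⟨x, hx⟩
  refine Eq.trans ?_ key
  congr 1
  funext i
  rw [Pi.sub_apply, Pi.add_apply, hwsum]
  by_cases hi : i ∈ J
  · simp [hi, hu i hi, LinearSeries.ratio, hs i hi]
  · simp [hi]

end

/-! ### Removing the conditions outside `J` -/

/-- If `J` has minimal defect, then every system whose equations in `J` have a common root belongs
to the consistency variety. -/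
theorem polyEval_eq_zero_of_defect_le {n k : ℕ} {X : Set (ℙ ℂ (Fin (n + 1) → ℂ))}
    (hX : IsIrredQuasiProjective X) (E : Fin k → LinearSeries X) (J : Finset (Fin k))
    (hJ : ∀ I, defect E J ≤ defect E I)
    (G : MvPolynomial (Module.Dual ℂ (∀ i, (E i).space)) ℂ)
    (hG : ∀ q ∈ incidenceVariety E, polyEval G q.2 = 0) (x : X) (s : ∀ i, (E i).space)
    (hs : ∀ i ∈ J, (E i).valueAt x (s i) = 0) : polyEval G s = 0 := by
  choose pt hpt using fun K : Finset (Fin k) =>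
    (LinearSeries.prod fun i : K => E i).exists_forall_zariskiDim_le hX.2
  -- The `f i` must be nonzero at `x` (index `none`), so that `x ∈ U`, and at the points `pt K`
  -- (index `some K`), so that the rank bounds the dimension for every `K`.
  choose f hf using fun i => (E i).exists_forall_mem_nonvanishing
    (fun o : Option (Finset (Fin k)) => o.elim x pt)
  let U : Set X := ⋂ i, (E i).nonvanishing (f i)
  have hUo : IsOpen[zariskiOn X] U := @isOpen_iInter_of_finite _ _ (zariskiOn X) _ _
    fun i => (E i).isOpen_nonvanishing (f i)
  have hxU : x ∈ U := Set.mem_iInter.2 fun i => hf i none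
  have hU : ∀ i, U ⊆ (E i).nonvanishing (f i) := fun i => Set.iInter_subset _ i
  have hdom := isDomain_regularFunctions hX.2 hUo ⟨x, hxU⟩
  set M := AlgebraicIndependent.matroid ℂ (regularFunctions U)
  let S : Fin k → Set (regularFunctions U) := fun i => Set.range ((E i).ratioOn (hU i))
  let P : Finset (Fin k) → LinearSeries X := fun K => LinearSeries.prod fun i : K => E i
  have hUK : ∀ K, U ⊆ (P K).nonvanishing (LinearSeries.prodSection _ fun i : K => f i) :=
    fun K y hy => (LinearSeries.mem_nonvanishing_prodSection_iff _ _ _).2 fun i => hU i hy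
  have hrank : ∀ K, M.eRk (Set.range ((P K).ratioOn (hUK K))) = M.eRk (⋃ i ∈ K, S i) := fun K => by
    rw [LinearSeries.eRk_range_ratioOn_prodSection (fun i : K => E i) (fun i => f i)
      (fun i => hU i) (hUK K)]
    congr 1
    exact Set.iUnion_subtype (fun i => i ∈ K) fun i => S i
  have hlow : ∀ K, (zariskiDim (Set.range (P K).kodaira) : ℕ∞) ≤ M.eRk (⋃ i ∈ K, S i) := fun K => by
    rw [← hrank]
    exact hpt K _ ((LinearSeries.mem_nonvanishing_prodSection_iff _ _ _).2 fun i => hf i (some K))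
      U hUo ⟨x, hxU⟩ (hUK K)
  have hupp : M.eRk (⋃ i ∈ J, S i) ≤ zariskiDim (Set.range (P J).kodaira) := by
    rw [← hrank]
    exact (P J).eRk_range_ratioOn_le_zariskiDim hX hUo ⟨x, hxU⟩ (hUK J)
  have hfin : ∀ i, M.IsRkFinite (S i) := fun i => Matroid.eRk_lt_top_iff.1
    (((E i).eRk_range_ratioOn_le (hU i)).trans_lt (ENat.natCast_lt_top _))
  have hfinJ : M.IsRkFinite (⋃ i ∈ J, S i) :=
    Matroid.eRk_lt_top_iff.1 (hupp.trans_lt (ENat.natCast_lt_top _))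
  -- Rado's condition relative to the quotients from `J` is the inequality of the defects of `J` and
  -- `J ∪ I`.
  obtain ⟨a, ha, hale⟩ := M.exists_transversal_add_card_le_eRk S hfin Jᶜ _ hfinJ fun I hI => by
    have hdisj : Disjoint J I := by
      rw [Finset.disjoint_left]
      exact fun i hi hi' => Finset.mem_compl.1 (hI hi') hi
    have h1 := hJ (J ∪ I)
    simp only [defect] at h1
    rw [Finset.card_union_of_disjoint hdisj] at h1
    have h2 : zariskiDim (Set.range (P J).kodaira) + I.card ≤
        zariskiDim (Set.range (P (J ∪ I)).kodaira) := by
      push_cast at h1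
      simp only [P]
      omega
    rw [← Finset.set_biUnion_union]
    refine le_trans (add_le_add_left hupp _) (le_trans ?_ (hlow (J ∪ I)))
    exact_mod_cast h2
  have hb : ∀ i, ∃ b, i ∉ J → (E i).ratioOn (hU i) b = a i := fun i => by
    by_cases hi : i ∈ J
    · exact ⟨0, fun h => absurd hi h⟩
    · obtain ⟨b, hb⟩ := ha i (Finset.mem_compl.2 hi)
      exact ⟨b, fun _ => hb⟩
  choose b hb using hb
  obtain ⟨A, hB₀, hind⟩ := AlgebraicIndependent.exists_of_eRk_add_card_le hfinJ
    (fun i : {i // i ∉ J} => a i) (by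
      have h1 : Set.range (fun i : {i // i ∉ J} => a i) = a '' (Jᶜ : Finset (Fin k)) := by
        ext y
        simp
      rw [h1]
      have h2 : Fintype.card {i // i ∉ J} = Jᶜ.card := by
        rw [Fintype.card_subtype_compl, Finset.card_compl]
        simp
      rw [h2]
      exact hale)
  refine polyEval_eq_zero_of_forall_incidenceVariety E f hU J A
    (fun i hi t => hB₀ (Set.mem_biUnion (show i ∈ (J : Set (Fin k)) from hi) ⟨t, rfl⟩)) b ?_ G hG
    hxU s hs
  have h1 : (fun i : {i // i ∉ J} => (E i).ratioOn (hU i) (b i)) =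
      fun i : {i // i ∉ J} => a i.1 := funext fun i => hb i.1 i.2
  rw [h1]
  exact hind

theorem mainTheorem5 {n k : ℕ} {X : Set (ℙ ℂ (Fin (n + 1) → ℂ))} (hX : IsIrredQuasiProjective X)
    (E : Fin k → LinearSeries X) (hE : IsOverdetermined E)
    (J : Finset (Fin k)) (hJ : IsEssential E J) :
    consistencyVariety E =
      (fun (s : ∀ i, (E i).space) (i : J) => s i) ⁻¹'
        consistencyVariety (fun i : J => E i) := by
  have hmin : ∀ I, defect E J ≤ defect E I := fun I => by
    rw [hJ.1]
    exact Finset.inf'_le _ (Finset.mem_univ I)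
  let l : (∀ i, (E i).space) →ₗ[ℂ] ∀ i : J, (E i).space :=
    LinearMap.pi fun i => LinearMap.proj i.1
  let l' : (∀ i : J, (E i).space) →ₗ[ℂ] ∀ i, (E i).space :=
    LinearMap.pi fun i => if h : i ∈ J then LinearMap.proj (⟨i, h⟩ : J) else 0
  apply Set.Subset.antisymm
  · refine @closure_minimal _ (affineZariski _) _ _ ?_ ?_
    · rintro _ ⟨⟨x, s⟩, hs, rfl⟩
      exact @subset_closure _ (affineZariski _) _ _ ⟨(x, fun i : J => s i), fun i => hs i, rfl⟩
    · have h1 := @isClosed_closure _ (affineZariski (∀ i : J, (E i).space))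
        (Prod.snd '' incidenceVariety fun i : J => E i)
      rw [← @isOpen_compl_iff _ _ (affineZariski _), isOpen_affineZariski_iff] at h1 ⊢
      intro s hs
      obtain ⟨F, hF, hF'⟩ := h1 _ hs
      obtain ⟨G, hG⟩ := exists_polyEval_comp l 0 F
      refine ⟨G, ?_, fun t ht => hF' (l t) ?_⟩
      · rw [hG, zero_add]
        exact hF
      · rwa [hG, zero_add] at ht
  · intro s hs
    by_contra hcon
    have h1 := @isClosed_closure _ (affineZariski (∀ i, (E i).space))
      (Prod.snd '' incidenceVariety E)
    rw [← @isOpen_compl_iff _ _ (affineZariski _), isOpen_affineZariski_iff] at h1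
    obtain ⟨G, hGs, hG⟩ := h1 s hcon
    have hG0 : ∀ q ∈ incidenceVariety E, polyEval G q.2 = 0 := fun q hq => by
      by_contra h
      exact hG _ h (@subset_closure _ (affineZariski _) _ _ ⟨q, hq, rfl⟩)
    -- `G'` is `G` on the affine slice where the components outside `J` are those of `s`. It
    -- vanishes on solvable `J`-systems, hence on their closure, and its value at the projection of
    -- `s` is `G(s)`.
    let s₀ : ∀ i, (E i).space := fun i => if i ∈ J then 0 else s i
    obtain ⟨G', hG'⟩ := exists_polyEval_comp l' s₀ G
    have hl' : ∀ t i, ∀ hi : i ∈ J, (s₀ + l' t) i = t ⟨i, hi⟩ := fun t i hi => by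
      simp [s₀, l', hi]
    have hG'0 : ∀ q ∈ incidenceVariety fun i : J => E i, polyEval G' q.2 = 0 := fun q hq => by
      rw [hG']
      refine polyEval_eq_zero_of_defect_le hX E J hmin G hG0 q.1 _ fun i hi => ?_
      rw [hl' _ i hi]
      exact ((E i).vanishes_iff_valueAt _ _).1 (hq ⟨i, hi⟩)
    have h2 : consistencyVariety (fun i : J => E i) ⊆ {t | polyEval G' t = 0} := by
      refine @closure_minimal _ (affineZariski _) _ _ ?_ ?_
      · rintro _ ⟨q, hq, rfl⟩
        exact hG'0 q hq
      · rw [← @isOpen_compl_iff _ _ (affineZariski _), isOpen_affineZariski_iff]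
        exact fun t ht => ⟨G', ht, fun t' ht' => ht'⟩
    have h3 := h2 hs
    refine hGs ?_
    rw [← show polyEval G' _ = polyEval G s from (hG' _).trans (congrArg _ ?_)]
    · exact h3
    · funext i
      by_cases hi : i ∈ J
      · rw [hl' _ i hi]
      · simp [s₀, l', hi]
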